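/- Let $G$ and $H$ be countable abelian groups, each endowed with a left-invariant metric that is proper (all closed balls are compact). Then the following three conditions are equivalent: 1. The metric spaces $G$ and $H$ are coarsely equivalent. 2. $\mathrm{asdim}(G)=\mathrm{asdim}(H)$, and the metric spaces $G,H$ are either both large scale connected or both not large scale connected. 3. $r_0(G)=r_0(H)$, and the groups $G,H$ are either both finitely generated or both not finitely generated. Here the notions are as follows. - A map $f:X\to Y$ between metric spaces is *bornologous* if $\sup\{\mathrm{diam}\,f(A): A\subseteq X,\ \mathrm{diam}\,A\le\delta\}<\infty$ for every $\delta<\infty$. Metric spaces $X,Y$ are *coarsely equivalent* if there are bornologous maps $f:X\to Y$, $g:Y\to X$ and a real constant $K$ such that $\mathrm{dist}(g(f(x)),x)\le K$ for all $x\in X$ and $\mathrm{dist}(f(g(y)),y)\le K$ for all $y\in Y$. - For a metric space $X$ and an integer $n\ge 0$, $\mathrm{asdim}(X)\le n$ means that for every $D\in[0,\infty)$ there is a cover $\mathcal U=\mathcal U_0\cup\dots\cup\mathcal U_n$ of $X$ with $\sup_{U\in\mathcal U}\mathrm{diam}(U)<\infty$ such that, for each $i\le n$ and any distinct $U,V\in\mathcal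 U_i$, $\inf\{\mathrm{dist}(u,v):u\in U,\ v\in V\}\ge D$. The *asymptotic dimension* $\mathrm{asdim}(X)\in\{0,1,2,\dots\}\cup\{\infty\}$ is the smallest $n$ with $\mathrm{asdim}(X)\le n$, or $\infty$ if there is no such $n$. - A metric space $X$ is *large scale connected* if there is $\varepsilon\in[0,\infty)$ such that any two points $x,y\in X$ can be linked by a finite chain $x=x_0,x_1,\dots,x_m=y$ with $\mathrm{dist}(x_i,x_{i+1})\le\varepsilon$ for all $i<m$. - The *torsion-free rank* is $r_0(G)=\sup\{n\ge 0:\mathbb Z^n\text{ is isomorphic to a subgroup of }G\}\in\{0,1,2,\dots\}\cup\{\infty\}$. -/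

import Mathlib

open scoped ENNReal NNReal

noncomputable section

namespace CoarseGeom

variable {X : Type*} [MetricSpace X] {Y : Type*} [MetricSpace Y]

/-- The continuity modulus `ω_f(δ) = sup {diam (f(A)) : A ⊆ X, diam A ≤ δ}`, as an element
of `[0, ∞]`. -/
def modulus (f : X → Y) (δ : ℝ≥0∞) : ℝ≥0∞ :=
  ⨆ (A : Set X) (_ : Metric.ediam A ≤ δ), Metric.ediam (f '' A)

/-- A map is bornologous if its continuity modulus is finite at every `δ < ∞`. -/
def Bornologous (f : X → Y) : Prop :=
  ∀ δ : ℝ≥0∞, δ < ∞ → modulus f δ < ∞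

variable (X Y) in
/-- Coarse equivalence of metric spaces. -/
def CoarselyEquivalent : Prop :=
  ∃ (f : X → Y) (g : Y → X) (K : ℝ), Bornologous f ∧ Bornologous g ∧
    (∀ x, dist (g (f x)) x ≤ K) ∧ (∀ y, dist (f (g y)) y ≤ K)

/-- The mesh of a family of sets: the supremum of the diameters of its members. -/
def mesh (𝒰 : Set (Set X)) : ℝ≥0∞ :=
  ⨆ U ∈ 𝒰, Metric.ediam U

/-- The distance `inf {dist (u, v) : u ∈ U, v ∈ V}` between two sets (`∞` if one is empty). -/
def setDist (U V : Set X) : ℝ≥0∞ :=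
  ⨅ u ∈ U, ⨅ v ∈ V, edist u v

/-- A family of sets is `D`-discrete if distinct members are at distance at least `D`. -/
def Discrete (D : ℝ≥0) (𝒰 : Set (Set X)) : Prop :=
  ∀ U ∈ 𝒰, ∀ V ∈ 𝒰, U ≠ V → (D : ℝ≥0∞) ≤ setDist U V

variable (X) in
/-- `asdim X ≤ n`: for every `D ∈ [0, ∞)` there is a cover of finite mesh which is the union of
`n + 1` subfamilies, each of them `D`-discrete. -/
def AsdimLE (n : ℕ) : Prop :=
  ∀ D : ℝ≥0, ∃ 𝒰 : Fin (n + 1) → Set (Set X),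
    ⋃₀ (⋃ i, 𝒰 i) = Set.univ ∧ mesh (⋃ i, 𝒰 i) < ∞ ∧ ∀ i, Discrete D (𝒰 i)

variable (X) in
/-- The asymptotic dimension: the smallest `n` with `asdim X ≤ n`, and `∞` if there is none. -/
def asdim : ℕ∞ :=
  ⨅ (n : ℕ) (_ : AsdimLE X n), (n : ℕ∞)

variable (X) in
/-- Any two points can be linked by an `ε`-chain `x = x₀, x₁, …, xₙ = y`. -/
def EpsConnected (ε : ℝ) : Prop :=
  ∀ x y : X, ∃ (n : ℕ) (c : ℕ → X), c 0 = x ∧ c n = y ∧ ∀ i < n, dist (c i) (c (i + 1)) ≤ ε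

variable (X) in
/-- Large scale connectedness: `ε`-connectedness for some `ε ∈ [0, ∞)`. -/
def LargeScaleConnected : Prop :=
  ∃ ε : ℝ, 0 ≤ ε ∧ EpsConnected X ε

/-- The torsion-free rank
`r₀(G) = sup {n : ℤⁿ is isomorphic to a subgroup of G}`, with values in `ℕ ∪ {∞}`. -/
def torsionFreeRank (G : Type*) [AddCommGroup G] : ℕ∞ :=
  ⨆ (n : ℕ) (_ : ∃ S : AddSubgroup G, Nonempty ((Fin n → ℤ) ≃+ S)), (n : ℕ∞)

end CoarseGeom

end

/-! A countable proper metric group has finite balls, so finite-set control between groups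
(`FinEquiv`) yields coarse equivalence for the given metrics. Asymptotic dimension and large scale
connectedness are coarse invariants. The rest is the computation of these invariants and a proof
that they determine the group up to `FinEquiv`.

Large scale connectedness is finite generation (`largeScaleConnected_iff_fg`), and asymptotic
dimension is torsion-free rank (`asdim_eq_torsionFreeRank`). The bound from below (`le_of_asdimLE`)
is Lebesgue's covering argument in an embedded `ℤ ^ n`, with a mod 2 cubical degree in place of
Brouwer's theorem. For the bound from above, the subgroup generated by a ball is finitely generated,
hence `ℤ ^ k` up to a finite kernel, with `k` at most the rank; shifted grids in `ℤ ^ k` pull back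
to the required cover.

For the classification, let `F` be the span of a maximal independent set. The torsion quotient `G ⧸
F` has a finitely controlled section, so `G` is equivalent to `F × (G ⧸ F)`
(`FinEquiv.prod_quotient`). A finite factor is negligible, and all infinite countable torsion groups
are equivalent (`FinEquiv.of_infinite_torsion`). Hence only the rank of `F` and the finiteness of
the quotient matter. In infinite rank the quotient may be finite although the group is not finitely
generated; then `F` supplies an infinite torsion factor, being equivalent to `F × (F ⧸ 2F)`. -/

noncomputable section

namespace CoarseGeom

/-! ### Mod 2 cubical cochains and a discrete Poincaré–Miranda theorem. -/

section CubicalDegree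

variable {ι : Type*} [DecidableEq ι]

/-- The value, modulo 2, of the cup product `dF i₁ ∪ ⋯ ∪ dF iₖ` on the fundamental chain of the
unit cube with lowest vertex `v` and edge directions `S`. -/
def cubeDegree (F : ι → (ι → ℕ) → ZMod 2) : List ι → (ι → ℕ) → Finset ι → ZMod 2
  | [], _, _ => 1
  | i :: L, v, S => ∑ j ∈ S, (F i (v + Pi.single j 1) + F i v) *
      cubeDegree F L (v + Pi.single j 1) (S.erase j)

/-- The cochain `F i ∪ dF i₁ ∪ ⋯ ∪ dF iₖ`. -/
def cubeWeight (F : ι → (ι → ℕ) → ZMod 2) (i : ι) (L : List ι) (v : ι → ℕ) (S : Finset ι) :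
    ZMod 2 :=
  F i v * cubeDegree F L v S

/-- The mod 2 coboundary of a cubical cochain. -/
def cubeCoboundary (η : (ι → ℕ) → Finset ι → ZMod 2) (v : ι → ℕ) (S : Finset ι) : ZMod 2 :=
  ∑ j ∈ S, (η v (S.erase j) + η (v + Pi.single j 1) (S.erase j))

/-- Each face of codimension two arises twice, once for each order of removing its two directions,
and the two contributions cancel mod 2. -/
theorem cubeCoboundary_cubeCoboundary (η : (ι → ℕ) → Finset ι → ZMod 2) (v : ι → ℕ)
    (S : Finset ι) : cubeCoboundary (cubeCoboundary η) v S = 0 := by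
  unfold cubeCoboundary
  simp_rw [← Finset.sum_add_distrib]
  rw [Finset.sum_sigma']
  refine Finset.sum_involution (fun p _ => ⟨p.2, p.1⟩) ?_ ?_ ?_ ?_
  · rintro ⟨i, j⟩ h
    simp only [Finset.erase_right_comm (a := i) (b := j), add_right_comm v (Pi.single i 1)]
    have h2 : (2 : ZMod 2) = 0 := rfl
    generalize η _ _ = a
    generalize η _ _ = b
    generalize η _ _ = c
    generalize η _ _ = d
    linear_combination (a + b + c + d) * h2
  · rintro ⟨i, j⟩ h _ h'
    simp only [Finset.mem_sigma, Finset.mem_erase] at h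
    exact h.2.1 (congrArg Sigma.fst h')
  · rintro ⟨i, j⟩ h
    simp only [Finset.mem_sigma, Finset.mem_erase] at h ⊢
    exact ⟨h.2.2, h.2.1.symm, h.1⟩
  · rintro ⟨i, j⟩ h
    rfl

/-- The Leibniz rule for the product of the 0-cochain `F i` with the cochain of `L`; signs disappear
mod 2. -/
theorem cubeDegree_cons_add (F : ι → (ι → ℕ) → ZMod 2) (i : ι) (L : List ι) (v : ι → ℕ)
    (S : Finset ι) : cubeDegree F (i :: L) v S = cubeCoboundary (cubeWeight F i L) v S +
      F i v * cubeCoboundary (cubeDegree F L) v S := by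
  unfold cubeCoboundary cubeWeight
  rw [Finset.mul_sum, ← Finset.sum_add_distrib, cubeDegree]
  refine Finset.sum_congr rfl fun j _ => ?_
  have h2 : (2 : ZMod 2) = 0 := rfl
  linear_combination -(F i v * cubeDegree F L v (S.erase j)) * h2

theorem cubeCoboundary_cubeDegree (F : ι → (ι → ℕ) → ZMod 2) (L : List ι) (v : ι → ℕ)
    (S : Finset ι) : cubeCoboundary (cubeDegree F L) v S = 0 := by
  induction L generalizing v S with
  | nil =>
    refine Finset.sum_eq_zero fun j _ => ?_
    simp only [cubeDegree]; rfl
  | cons i L ih =>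
    have : cubeDegree F (i :: L) = cubeCoboundary (cubeWeight F i L) := by
      ext v S
      rw [cubeDegree_cons_add, ih, mul_zero, add_zero]
    rw [this, cubeCoboundary_cubeCoboundary]

theorem cubeDegree_cons (F : ι → (ι → ℕ) → ZMod 2) (i : ι) (L : List ι) (v : ι → ℕ)
    (S : Finset ι) : cubeDegree F (i :: L) v S = cubeCoboundary (cubeWeight F i L) v S := by
  rw [cubeDegree_cons_add, cubeCoboundary_cubeDegree, mul_zero, add_zero]

/-- The vertices of the unit cube with lowest vertex `v` and edge directions `S`. -/
def cubeVertices (v : ι → ℕ) (S : Finset ι) : Set (ι → ℕ) :=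
  {x | ∀ j, x j = v j ∨ j ∈ S ∧ x j = v j + 1}

theorem self_mem_cubeVertices {ι : Type*} (v : ι → ℕ) (S : Finset ι) : v ∈ cubeVertices v S :=
  fun _ => Or.inl rfl

theorem cubeVertices_erase_subset {v : ι → ℕ} {S : Finset ι} {j : ι} (hj : j ∈ S) :
    cubeVertices (v + Pi.single j 1) (S.erase j) ⊆ cubeVertices v S := by
  intro x hx k
  by_cases hk : k = j
  · subst hk
    have := hx k
    simp at this
    exact Or.inr ⟨hj, this⟩
  · have := hx k
    simp [hk] at this
    exact this

theorem cubeDegree_eq_zero (F : ι → (ι → ℕ) → ZMod 2) {i : ι} {L : List ι} (hi : i ∈ L)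
    {v : ι → ℕ} {S : Finset ι}
    (h : ∀ x ∈ cubeVertices v S, ∀ y ∈ cubeVertices v S, F i x = F i y) :
    cubeDegree F L v S = 0 := by
  induction L generalizing v S with
  | nil => simp at hi
  | cons k L ih =>
    refine Finset.sum_eq_zero fun j hj => ?_
    rcases List.mem_cons.1 hi with rfl | hi
    · rw [h (v + Pi.single j 1) (cubeVertices_erase_subset hj (self_mem_cubeVertices _ _)) v
        (self_mem_cubeVertices _ _), CharTwo.add_self_eq_zero, zero_mul]
    · rw [ih hi fun x hx y hy => h x (cubeVertices_erase_subset hj hx) y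
        (cubeVertices_erase_subset hj hy), mul_zero]

variable [Fintype ι]

/-- The lowest vertices of the unit cubes in the face of `{0, …, N}^ι` on which the coordinates
outside `S` are equal to `N`. -/
def faceBox (N : ℕ) (S : Finset ι) : Finset (ι → ℕ) :=
  Fintype.piFinset fun i => if i ∈ S then Finset.range N else {N}

theorem mem_faceBox {N : ℕ} {S : Finset ι} {v : ι → ℕ} :
    v ∈ faceBox N S ↔ ∀ i, (i ∈ S → v i < N) ∧ (i ∉ S → v i = N) := by
  simp only [faceBox, Fintype.mem_piFinset]
  refine forall_congr' fun i => ?_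
  by_cases h : i ∈ S <;> simp [h]

theorem sum_faceBox {M : Type*} [AddCommMonoid M] (N : ℕ) {S : Finset ι} {i : ι} (hi : i ∈ S)
    (g : (ι → ℕ) → M) : ∑ v ∈ faceBox N S, g v =
      ∑ u ∈ faceBox N (S.erase i), ∑ t ∈ Finset.range N, g (Function.update u i t) := by
  rw [Finset.sum_sigma']
  refine Finset.sum_bij' (fun v _ => ⟨Function.update v i N, v i⟩)
    (fun p _ => Function.update p.1 i p.2) ?_ ?_ ?_ ?_ ?_
  · intro v hv
    rw [mem_faceBox] at hv
    simp only [Finset.mem_sigma, mem_faceBox, Finset.mem_range]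
    refine ⟨fun j => ?_, (hv i).1 hi⟩
    by_cases hj : j = i
    · subst hj; simp
    · simpa [hj] using hv j
  · rintro ⟨u, t⟩ h
    simp only [Finset.mem_sigma, mem_faceBox, Finset.mem_range] at h
    rw [mem_faceBox]
    intro j
    by_cases hj : j = i
    · subst hj; simp [h.2, hi]
    · simpa [hj] using h.1 j
  · intro v _; simp
  · rintro ⟨u, t⟩ h
    simp only [Finset.mem_sigma, mem_faceBox, Finset.mem_range] at h
    have hu : u i = N := by simpa using (h.1 i).2
    simp [← hu]
  · intro v _; simp

theorem sum_range_add_succ (N : ℕ) (g : ℕ → ZMod 2) :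
    ∑ t ∈ Finset.range N, (g t + g (t + 1)) = g 0 + g N := by
  induction N with
  | zero => simp [CharTwo.add_self_eq_zero]
  | succ n ih =>
    rw [Finset.sum_range_succ, ih]
    have h2 : (2 : ZMod 2) = 0 := rfl
    linear_combination g n * h2

/-- Stokes' theorem and induction on dimension. The cochain is a coboundary, so its sum telescopes
to the boundary of the box. On faces orthogonal to a direction `j` of `L`, `F j` is constant and
kills the product; the face where coordinate `i` is `0` has weight `0`, and the opposite one gives
the sum for `L`. -/
theorem sum_cubeDegree_faceBox (F : ι → (ι → ℕ) → ZMod 2) (N : ℕ)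
    (h0 : ∀ i x, x i = 0 → F i x = 0) (hN : ∀ i x, x i = N → F i x = 1) (L : List ι)
    (hL : L.Nodup) : ∑ v ∈ faceBox N L.toFinset, cubeDegree F L v L.toFinset = 1 := by
  induction L with
  | nil =>
    have : faceBox N (∅ : Finset ι) = {fun _ => N} := by
      ext v; simp [mem_faceBox, funext_iff]
    simp [cubeDegree, this]
  | cons i L ih =>
    have hiL : i ∉ L := (List.nodup_cons.1 hL).1
    have hS : (i :: L).toFinset.erase i = L.toFinset := by
      rw [List.toFinset_cons, Finset.erase_insert (by simpa using hiL)]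
    simp_rw [cubeDegree_cons]
    unfold cubeCoboundary
    rw [Finset.sum_comm]
    have key : ∀ j ∈ (i :: L).toFinset,
        ∑ v ∈ faceBox N (i :: L).toFinset,
          (cubeWeight F i L v ((i :: L).toFinset.erase j) +
            cubeWeight F i L (v + Pi.single j 1) ((i :: L).toFinset.erase j)) =
        ∑ u ∈ faceBox N ((i :: L).toFinset.erase j),
          (cubeWeight F i L (Function.update u j 0) ((i :: L).toFinset.erase j) +
            cubeWeight F i L (Function.update u j N) ((i :: L).toFinset.erase j)) := by
      intro j hj
      rw [sum_faceBox N hj]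
      refine Finset.sum_congr rfl fun u _ => ?_
      rw [← sum_range_add_succ N fun t =>
        cubeWeight F i L (Function.update u j t) ((i :: L).toFinset.erase j)]
      refine Finset.sum_congr rfl fun t _ => ?_
      congr 2
      ext k
      by_cases hk : k = j
      · subst hk; simp
      · simp [hk]
    rw [Finset.sum_congr rfl key, Finset.sum_eq_single i]
    · rw [hS, ← ih (List.nodup_cons.1 hL).2]
      refine Finset.sum_congr rfl fun u hu => ?_
      have hui : u i = N := ((mem_faceBox.1 hu) i).2 (by simpa using hiL)
      unfold cubeWeight
      rw [h0 i _ (by simp), hN i _ (by simp), ← hui]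
      simp
    · intro j hj hji
      have hjL : j ∈ L := by simpa [hji] using hj
      refine Finset.sum_eq_zero fun u _ => ?_
      have face : ∀ t, ∀ x ∈ cubeVertices (Function.update u j t) ((i :: L).toFinset.erase j),
          x j = t := by
        intro t x hx
        simpa using hx j
      unfold cubeWeight
      rw [cubeDegree_eq_zero F hjL, cubeDegree_eq_zero F hjL]
      · simp
      · intro x hx y hy
        rw [hN j x (face N x hx), hN j y (face N y hy)]
      · intro x hx y hy
        rw [h0 j x (face 0 x hx), h0 j y (face 0 y hy)]
    · intro h; simp at h

/-- A discrete Poincaré–Miranda theorem. -/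
theorem exists_unitCube_forall_not_const (F : ι → (ι → ℕ) → ZMod 2) (N : ℕ)
    (h0 : ∀ i x, x i = 0 → F i x = 0) (hN : ∀ i x, x i = N → F i x = 1) :
    ∃ v : ι → ℕ, (∀ i, v i < N) ∧ ∀ i, ¬ ∀ x y : ι → ℕ,
      (∀ j, x j = v j ∨ x j = v j + 1) → (∀ j, y j = v j ∨ y j = v j + 1) → F i x = F i y := by
  have h := sum_cubeDegree_faceBox F N h0 hN (Finset.univ : Finset ι).toList
    (Finset.nodup_toList _)
  rw [Finset.toList_toFinset] at h
  obtain ⟨v, hv, hne⟩ := Finset.exists_ne_zero_of_sum_ne_zero (h.trans_ne one_ne_zero)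
  refine ⟨v, fun i => ((mem_faceBox.1 hv) i).1 (Finset.mem_univ i), fun i hi => hne ?_⟩
  exact cubeDegree_eq_zero F (i := i) (by simp) fun x hx y hy =>
    hi x y (by simpa [cubeVertices] using hx) (by simpa [cubeVertices] using hy)

end CubicalDegree

/-! ### Coarse equivalence of groups, expressed by finite subsets. -/

section FinEquiv

/-- A map between abelian groups is bornologous for the coarse structures generated by the finite
subsets. -/
def FinBornologous {A B : Type*} [AddCommGroup A] [AddCommGroup B] (f : A → B) : Prop :=
  ∀ S : Set A, S.Finite → ∃ T : Set B, T.Finite ∧ ∀ x y, y - x ∈ S → f y - f x ∈ T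

/-- Coarse equivalence of abelian groups for the coarse structures generated by the finite
subsets. -/
def FinEquiv (A B : Type*) [AddCommGroup A] [AddCommGroup B] : Prop :=
  ∃ (f : A → B) (g : B → A), FinBornologous f ∧ FinBornologous g ∧
    (∃ S : Set A, S.Finite ∧ ∀ x, g (f x) - x ∈ S) ∧
    ∃ T : Set B, T.Finite ∧ ∀ y, f (g y) - y ∈ T

variable {A B C D : Type*} [AddCommGroup A] [AddCommGroup B] [AddCommGroup C] [AddCommGroup D]

theorem FinBornologous.comp {g : B → C} {f : A → B} (hg : FinBornologous g)
    (hf : FinBornologous f) : FinBornologous (g ∘ f) := by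
  intro S hS
  obtain ⟨T, hT, h⟩ := hf S hS
  obtain ⟨U, hU, h'⟩ := hg T hT
  exact ⟨U, hU, fun x y hxy => h' _ _ (h _ _ hxy)⟩

theorem FinBornologous.of_addMonoidHom (f : A →+ B) : FinBornologous f := fun S hS =>
  ⟨f '' S, hS.image f, fun x y h => ⟨_, h, map_sub f y x⟩⟩

theorem FinBornologous.prodMap {f : A → B} {g : C → D} (hf : FinBornologous f)
    (hg : FinBornologous g) : FinBornologous (Prod.map f g) := by
  intro S hS
  obtain ⟨T, hT, h⟩ := hf _ (hS.image Prod.fst)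
  obtain ⟨U, hU, h'⟩ := hg _ (hS.image Prod.snd)
  exact ⟨T ×ˢ U, hT.prod hU, fun x y hxy => ⟨h _ _ ⟨_, hxy, rfl⟩, h' _ _ ⟨_, hxy, rfl⟩⟩⟩

theorem FinEquiv.symm (h : FinEquiv A B) : FinEquiv B A := by
  obtain ⟨f, g, hf, hg, h1, h2⟩ := h
  exact ⟨g, f, hg, hf, h2, h1⟩

theorem FinEquiv.of_addEquiv (e : A ≃+ B) : FinEquiv A B :=
  ⟨e, e.symm, .of_addMonoidHom e.toAddMonoidHom, .of_addMonoidHom e.symm.toAddMonoidHom,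
    ⟨{0}, Set.finite_singleton _, by simp⟩, ⟨{0}, Set.finite_singleton _, by simp⟩⟩

theorem FinEquiv.refl (A : Type*) [AddCommGroup A] : FinEquiv A A :=
  .of_addEquiv (AddEquiv.refl A)

theorem FinBornologous.finite_comp_sub {C : Type*} {f : A → B} {g : B → A} {f' : B → C} {g' : C → B}
    (hg : FinBornologous g) (h : ∃ S : Set A, S.Finite ∧ ∀ x, g (f x) - x ∈ S)
    (h' : ∃ S : Set B, S.Finite ∧ ∀ x, g' (f' x) - x ∈ S) :
    ∃ S : Set A, S.Finite ∧ ∀ x, (g ∘ g') ((f' ∘ f) x) - x ∈ S := by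
  obtain ⟨S, hS, h⟩ := h
  obtain ⟨T, hT, h'⟩ := h'
  obtain ⟨U, hU, hgU⟩ := hg T hT
  refine ⟨Set.image2 (· + ·) U S, hU.image2 _ hS, fun x => ?_⟩
  exact ⟨_, hgU _ _ (h' (f x)), _, h x, by simp⟩

theorem FinEquiv.trans (h : FinEquiv A B) (h' : FinEquiv B C) : FinEquiv A C := by
  obtain ⟨f, g, hf, hg, h1, h2⟩ := h
  obtain ⟨f', g', hf', hg', h1', h2'⟩ := h'
  exact ⟨f' ∘ f, g ∘ g', hf'.comp hf, hg.comp hg', hg.finite_comp_sub h1 h1',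
    hf'.finite_comp_sub h2' h2⟩

theorem FinEquiv.prod (h : FinEquiv A B) (h' : FinEquiv C D) : FinEquiv (A × C) (B × D) := by
  obtain ⟨f, g, hf, hg, ⟨S, hS, h1⟩, ⟨T, hT, h2⟩⟩ := h
  obtain ⟨f', g', hf', hg', ⟨S', hS', h1'⟩, ⟨T', hT', h2'⟩⟩ := h'
  exact ⟨Prod.map f f', Prod.map g g', hf.prodMap hf', hg.prodMap hg',
    ⟨S ×ˢ S', hS.prod hS', fun x => ⟨h1 x.1, h1' x.2⟩⟩,
    ⟨T ×ˢ T', hT.prod hT', fun x => ⟨h2 x.1, h2' x.2⟩⟩⟩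

theorem FinEquiv.prod_finite (A T : Type*) [AddCommGroup A] [AddCommGroup T] [Finite T] :
    FinEquiv (A × T) A := by
  refine ⟨Prod.fst, fun a => (a, 0), .of_addMonoidHom (AddMonoidHom.fst A T),
    .of_addMonoidHom (AddMonoidHom.inl A T), ⟨{0} ×ˢ Set.univ,
      (Set.finite_singleton _).prod Set.finite_univ, by simp⟩,
    ⟨{0}, Set.finite_singleton _, by simp⟩⟩

end FinEquiv

/-! ### From finite sets to proper invariant metrics. -/

section MetricGroup

variable {G : Type*} [AddCommGroup G] [MetricSpace G] [IsIsometricVAdd G G]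

theorem dist_eq_dist_zero_sub (x y : G) : dist x y = dist 0 (y - x) := by
  have := dist_vadd (-x) x y
  simp only [vadd_eq_add, neg_add_cancel, neg_add_eq_sub] at this
  exact this.symm

theorem edist_eq_edist_zero_sub (x y : G) : edist x y = edist 0 (y - x) := by
  rw [edist_dist, edist_dist, dist_eq_dist_zero_sub]

variable [Countable G] [ProperSpace G]

/-- By Baire's theorem one of the countably many singletons has interior; translations carry this to
all points. -/
theorem discreteTopology_of_countable : DiscreteTopology G := by
  obtain ⟨x, hx⟩ := nonempty_interior_of_iUnion_of_closed (f := fun x : G => ({x} : Set G))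
    (fun _ => isClosed_singleton) (by ext; simp)
  have hopen : IsOpen ({x} : Set G) := by
    rcases Set.subset_singleton_iff_eq.1 (interior_subset (s := ({x} : Set G))) with h | h
    · exact absurd hx (by simp [h])
    · exact interior_eq_iff_isOpen.1 h
  refine discreteTopology_iff_isOpen_singleton.2 fun y => ?_
  have hcont : Continuous (fun z : G => (x - y) +ᵥ z) := (isometry_vadd G (x - y)).continuous
  have : (fun z : G => (x - y) +ᵥ z) ⁻¹' {x} = {y} := by
    ext z
    simp only [vadd_eq_add, Set.mem_preimage, Set.mem_singleton_iff]
    constructor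
    · intro h
      have : z = x - (x - y) := by rw [eq_sub_iff_add_eq, add_comm, h]
      simpa using this
    · rintro rfl; abel
  rw [← this]
  exact hopen.preimage hcont

theorem finite_closedBall (x : G) (r : ℝ) : (Metric.closedBall x r).Finite := by
  have := discreteTopology_of_countable (G := G)
  exact (isCompact_closedBall x r).finite_of_discrete

variable {H : Type*} [AddCommGroup H] [MetricSpace H] [IsIsometricVAdd H H]

theorem edist_le_of_mem_finite {S : Set H} (hS : S.Finite) :
    ∃ R : ℝ≥0, ∀ x y : H, y - x ∈ S → edist x y ≤ R := by
  obtain ⟨R, hR⟩ := (hS.image fun s => nndist 0 s).bddAbove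
  refine ⟨R, fun x y h => ?_⟩
  rw [edist_eq_edist_zero_sub, edist_nndist]
  exact_mod_cast hR ⟨_, h, rfl⟩

theorem FinBornologous.bornologous {f : G → H} (hf : FinBornologous f) : Bornologous f := by
  intro δ hδ
  obtain ⟨T, hT, h⟩ := hf _ (finite_closedBall (0 : G) δ.toReal)
  obtain ⟨R, hR⟩ := edist_le_of_mem_finite hT
  refine lt_of_le_of_lt (b := (R : ℝ≥0∞)) ?_ ENNReal.coe_lt_top
  refine iSup₂_le fun A hA => Metric.ediam_le ?_
  rintro _ ⟨x, hx, rfl⟩ _ ⟨y, hy, rfl⟩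
  refine hR _ _ (h _ _ ?_)
  have hxy : edist x y ≤ δ := (Metric.edist_le_ediam_of_mem hx hy).trans hA
  rw [Metric.mem_closedBall, dist_comm, ← dist_eq_dist_zero_sub, dist_edist]
  exact ENNReal.toReal_mono hδ.ne hxy

variable [Countable H] [ProperSpace H]

theorem FinEquiv.coarselyEquivalent (h : FinEquiv G H) : CoarselyEquivalent G H := by
  obtain ⟨f, g, hf, hg, ⟨S, hS, h1⟩, ⟨T, hT, h2⟩⟩ := h
  obtain ⟨R, hR⟩ := edist_le_of_mem_finite hS
  obtain ⟨R', hR'⟩ := edist_le_of_mem_finite hT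
  refine ⟨f, g, max R R', hf.bornologous, hg.bornologous, fun x => ?_, fun y => ?_⟩
  · have := hR _ _ (h1 x)
    rw [edist_nndist, ENNReal.coe_le_coe, ← NNReal.coe_le_coe, coe_nndist, dist_comm] at this
    exact this.trans (le_max_left _ _)
  · have := hR' _ _ (h2 y)
    rw [edist_nndist, ENNReal.coe_le_coe, ← NNReal.coe_le_coe, coe_nndist, dist_comm] at this
    exact this.trans (le_max_right _ _)

end MetricGroup

/-! ### Large scale connectedness and finite generation. -/

section LargeScaleConnected

variable {G : Type*} [AddCommGroup G] [MetricSpace G] [IsIsometricVAdd G G]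

theorem largeScaleConnected_of_fg (hG : AddGroup.FG G) : LargeScaleConnected G := by
  obtain ⟨S, hS, hSf⟩ := AddGroup.fg_iff.1 hG
  obtain ⟨R, hR⟩ := edist_le_of_mem_finite (H := G) hSf
  have hR' : ∀ x y : G, y - x ∈ S → dist x y ≤ R := by
    intro x y h
    have := hR x y h
    rwa [edist_nndist, ENNReal.coe_le_coe, ← NNReal.coe_le_coe, coe_nndist] at this
  have key : ∀ g : G, ∀ x : G, Relation.ReflTransGen (fun a b : G => dist a b ≤ R) x (x + g) := by
    intro g
    have hg : g ∈ AddSubgroup.closure S := hS ▸ AddSubgroup.mem_top g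
    induction hg using AddSubgroup.closure_induction with
    | mem s hs => exact fun x => .single (hR' _ _ (by simpa using hs))
    | zero => intro x; rw [add_zero]
    | add a b _ _ ha hb =>
      intro x; rw [← add_assoc]; exact (ha x).trans (hb _)
    | neg a _ ha =>
      intro x
      have := ha (x + -a)
      rw [neg_add_cancel_right] at this
      rw [← Relation.reflTransGen_swap] at this
      have hswap : Function.swap (fun a b : G => dist a b ≤ R) = fun a b => dist a b ≤ R := by
        ext a b
        rw [Function.swap, dist_comm]
      rwa [hswap] at this
  refine ⟨R, R.2, fun x y => ?_⟩
  have := key (y - x) x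
  rw [add_sub_cancel] at this
  induction this with
  | refl => exact ⟨0, fun _ => x, rfl, rfl, by simp⟩
  | @tail b d _ hbd ih =>
    obtain ⟨n, c, h0, hn, hc⟩ := ih
    refine ⟨n + 1, fun i => if i ≤ n then c i else d, by simp [h0], by simp, fun i hi => ?_⟩
    rcases (Nat.lt_succ_iff.1 hi).lt_or_eq with h | rfl
    · simp [h.le, Nat.succ_le_of_lt h, hc i h]
    · simpa [hn] using hbd

/-- The increments of an `ε`-chain from `0` lie in the ball of radius `ε`, which is finite and
therefore a finite generating set. -/
theorem fg_of_largeScaleConnected [Countable G] [ProperSpace G] (hG : LargeScaleConnected G) :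
    AddGroup.FG G := by
  obtain ⟨ε, -, h⟩ := hG
  refine AddGroup.fg_iff.2 ⟨Metric.closedBall 0 ε, ?_, finite_closedBall 0 ε⟩
  rw [eq_top_iff]
  rintro x -
  obtain ⟨n, c, h0, hn, hc⟩ := h 0 x
  suffices ∀ i ≤ n, c i ∈ AddSubgroup.closure (Metric.closedBall (0 : G) ε) from hn ▸ this n le_rfl
  intro i
  induction i with
  | zero => intro _; rw [h0]; exact zero_mem _
  | succ i ih =>
    intro hi
    rw [← sub_add_cancel (c (i + 1)) (c i)]
    refine add_mem (AddSubgroup.subset_closure ?_) (ih (by omega))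
    rw [Metric.mem_closedBall, dist_comm, ← dist_eq_dist_zero_sub]
    exact hc i (by omega)

theorem largeScaleConnected_iff_fg [Countable G] [ProperSpace G] :
    LargeScaleConnected G ↔ AddGroup.FG G :=
  ⟨fg_of_largeScaleConnected, largeScaleConnected_of_fg⟩

end LargeScaleConnected

/-! ### Coarse invariance of connectedness and of asymptotic dimension. -/

section CoarseInvariance

variable {X Y : Type*} [MetricSpace X] [MetricSpace Y]

theorem Bornologous.exists_dist_le {f : X → Y} (hf : Bornologous f) (δ : ℝ≥0) :
    ∃ R : ℝ≥0, ∀ x y, nndist x y ≤ δ → nndist (f x) (f y) ≤ R := by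
  obtain ⟨R, hR⟩ := ENNReal.lt_iff_exists_coe.1 (hf δ ENNReal.coe_lt_top)
  refine ⟨R, fun x y h => ?_⟩
  rw [← ENNReal.coe_le_coe, ← edist_nndist, ← hR.1]
  refine le_trans ?_ (le_iSup₂ (f := fun (A : Set X) (_ : Metric.ediam A ≤ δ) =>
    Metric.ediam (f '' A)) {x, y} ?_)
  · exact Metric.edist_le_ediam_of_mem ⟨x, by simp, rfl⟩ ⟨y, by simp, rfl⟩
  · rw [Metric.ediam_pair, edist_nndist]
    exact_mod_cast h

theorem CoarselyEquivalent.symm (h : CoarselyEquivalent X Y) : CoarselyEquivalent Y X := by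
  obtain ⟨f, g, K, hf, hg, h1, h2⟩ := h
  exact ⟨g, f, K, hg, hf, h2, h1⟩

theorem LargeScaleConnected.of_coarselyEquivalent (h : CoarselyEquivalent X Y)
    (hX : LargeScaleConnected X) : LargeScaleConnected Y := by
  obtain ⟨f, g, K, hf, hg, h1, h2⟩ := h
  obtain ⟨ε, hε, hc⟩ := hX
  obtain ⟨R, hR⟩ := hf.exists_dist_le ⟨ε, hε⟩
  refine ⟨max R K, le_max_of_le_left R.2, fun x y => ?_⟩
  obtain ⟨n, c, h0, hn, hcn⟩ := hc (g x) (g y)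
  refine ⟨n + 2, fun i => if i = 0 then x else if i ≤ n + 1 then f (c (i - 1)) else y, by simp,
    by simp, fun i hi => ?_⟩
  rcases Nat.eq_zero_or_pos i with rfl | hi0
  · simp only [if_true, zero_add, one_ne_zero, if_false]
    rw [if_pos (by omega), Nat.sub_self, h0, dist_comm]
    exact (h2 x).trans (le_max_right _ _)
  · rcases (show i ≤ n + 1 by omega).lt_or_eq with h | rfl
    · simp only [hi0.ne', if_false, h.le, if_true, Nat.succ_le_of_lt h, Nat.add_sub_cancel,
        Nat.succ_ne_zero]
      refine le_trans ?_ (le_max_left _ _)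
      have := hcn (i - 1) (by omega)
      rw [Nat.sub_add_cancel hi0] at this
      exact hR _ _ this
    · simp [hn]
      exact Or.inr (h2 y)

theorem mesh_lt_top_iff {𝒰 : Set (Set X)} :
    mesh 𝒰 < ∞ ↔ ∃ R : ℝ≥0, ∀ U ∈ 𝒰, ∀ x ∈ U, ∀ y ∈ U, nndist x y ≤ R := by
  constructor
  · intro h
    obtain ⟨R, hR⟩ := ENNReal.lt_iff_exists_coe.1 h
    refine ⟨R, fun U hU x hx y hy => ?_⟩
    rw [← ENNReal.coe_le_coe, ← edist_nndist, ← hR.1]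
    exact (Metric.edist_le_ediam_of_mem hx hy).trans
      (le_iSup₂ (f := fun (U : Set X) (_ : U ∈ 𝒰) => Metric.ediam U) U hU)
  · rintro ⟨R, hR⟩
    refine lt_of_le_of_lt (b := (R : ℝ≥0∞)) ?_ ENNReal.coe_lt_top
    refine iSup₂_le fun U hU => Metric.ediam_le fun x hx y hy => ?_
    rw [edist_nndist]
    exact_mod_cast hR U hU x hx y hy

theorem discrete_iff {D : ℝ≥0} {𝒰 : Set (Set X)} :
    Discrete D 𝒰 ↔ ∀ U ∈ 𝒰, ∀ V ∈ 𝒰, U ≠ V → ∀ x ∈ U, ∀ y ∈ V, D ≤ nndist x y := by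
  simp only [Discrete, setDist, le_iInf_iff, edist_nndist, ENNReal.coe_le_coe]

/-- A reformulation of `AsdimLE` with real-valued bounds. -/
theorem asdimLE_iff {n : ℕ} : AsdimLE X n ↔ ∀ D : ℝ≥0, ∃ 𝒰 : Fin (n + 1) → Set (Set X),
    (∀ x, ∃ i, ∃ U ∈ 𝒰 i, x ∈ U) ∧
    (∃ R : ℝ≥0, ∀ i, ∀ U ∈ 𝒰 i, ∀ x ∈ U, ∀ y ∈ U, nndist x y ≤ R) ∧
    ∀ i, ∀ U ∈ 𝒰 i, ∀ V ∈ 𝒰 i, U ≠ V → ∀ x ∈ U, ∀ y ∈ V, D ≤ nndist x y := by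
  refine forall_congr' fun D => exists_congr fun 𝒰 => ?_
  refine and_congr ?_ (and_congr ?_ (forall_congr' fun i => discrete_iff))
  · simp only [Set.eq_univ_iff_forall, Set.mem_sUnion, Set.mem_iUnion]
    refine forall_congr' fun x => ⟨?_, ?_⟩
    · rintro ⟨U, ⟨i, hi⟩, hx⟩; exact ⟨i, U, hi, hx⟩
    · rintro ⟨i, U, hi, hx⟩; exact ⟨U, ⟨i, hi⟩, hx⟩
  · rw [mesh_lt_top_iff]
    refine exists_congr fun R => ⟨fun h i U hU => h U (Set.mem_iUnion.2 ⟨i, hU⟩), fun h U hU => ?_⟩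
    obtain ⟨i, hi⟩ := Set.mem_iUnion.1 hU
    exact h i U hi

/-- Covers pull back along `g`. Separation survives because `g` is bornologous, boundedness because
`f` is bornologous and `f ∘ g` is close to the identity. -/
theorem AsdimLE.of_coarselyEquivalent {n : ℕ} (h : CoarselyEquivalent X Y) (hX : AsdimLE X n) :
    AsdimLE Y n := by
  obtain ⟨f, g, K, hf, hg, h1, h2⟩ := h
  rw [asdimLE_iff] at hX ⊢
  intro D
  obtain ⟨D', hD'⟩ := hg.exists_dist_le D
  obtain ⟨𝒰, hcov, ⟨R, hR⟩, hdisc⟩ := hX (D' + 1)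
  obtain ⟨R', hR'⟩ := hf.exists_dist_le R
  refine ⟨fun i => (fun U => g ⁻¹' U) '' 𝒰 i, fun y => ?_, ⟨K.toNNReal + R' + K.toNNReal, ?_⟩, ?_⟩
  · obtain ⟨i, U, hU, hx⟩ := hcov (g y)
    exact ⟨i, _, ⟨U, hU, rfl⟩, hx⟩
  · rintro i _ ⟨U, hU, rfl⟩ x hx y hy
    have h3 := hR' _ _ (hR i U hU _ hx _ hy)
    have hK : ∀ y, nndist (f (g y)) y ≤ K.toNNReal := fun y => by
      rw [← NNReal.coe_le_coe, coe_nndist]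
      exact (h2 y).trans (Real.le_coe_toNNReal K)
    refine (nndist_triangle _ (f (g y)) _).trans (add_le_add ?_ (hK y))
    refine (nndist_triangle _ (f (g x)) _).trans (add_le_add ?_ h3)
    rw [nndist_comm]
    exact hK x
  · rintro i _ ⟨U, hU, rfl⟩ _ ⟨V, hV, rfl⟩ hne x hx y hy
    by_contra hlt
    have h3 := hdisc i U hU V hV (fun h => hne (by rw [h])) _ hx _ hy
    have h4 := hD' _ _ (not_le.1 hlt).le
    exact absurd (h3.trans h4) (by simp)

theorem asdim_eq_of_coarselyEquivalent (h : CoarselyEquivalent X Y) : asdim X = asdim Y := by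
  unfold asdim
  congr! 3 with n
  exact ⟨.of_coarselyEquivalent h, .of_coarselyEquivalent h.symm⟩

end CoarseInvariance

/-! ### Rank bounds asymptotic dimension from below. -/

section LowerBound

theorem nndist_le_of_mem_finite {G : Type*} [AddCommGroup G] [MetricSpace G]
    [IsIsometricVAdd G G] {S : Set G} (hS : S.Finite) :
    ∃ R : ℝ≥0, ∀ x y : G, y - x ∈ S → nndist x y ≤ R := by
  obtain ⟨R, hR⟩ := edist_le_of_mem_finite hS
  refine ⟨R, fun x y h => ?_⟩
  have := hR x y h
  rwa [edist_nndist, ENNReal.coe_le_coe] at this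

variable {G : Type*} [AddCommGroup G] [MetricSpace G] [IsIsometricVAdd G G] [Countable G]
  [ProperSpace G]

theorem exists_natAbs_lt {n : ℕ} {S : Set (Fin n → ℤ)} (hS : S.Finite) :
    ∃ N : ℕ, 0 < N ∧ ∀ z ∈ S, ∀ i, (z i).natAbs < N := by
  obtain ⟨M, hM⟩ := (hS.image fun z => ∑ i, (z i).natAbs).bddAbove
  refine ⟨M + 1, M.succ_pos, fun z hz i => Nat.lt_succ_of_le ?_⟩
  exact (Finset.single_le_sum (f := fun i => (z i).natAbs) (fun _ _ => Nat.zero_le _)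
    (Finset.mem_univ i)).trans (hM ⟨z, hz, rfl⟩)

/-- If there were fewer colours than directions plus one, each colour would give a label separating
a pair of opposite faces of a large cube. Some unit cube would be constant for no label, yet a
thickened member of the cover contains that cube and makes the label of its own colour constant. -/
theorem le_of_asdimLE {n m : ℕ} (φ : (Fin n → ℤ) →+ G) (hφ : Function.Injective φ)
    (h : AsdimLE G m) : n ≤ m := by
  classical
  by_contra! hmn
  let q : (Fin n → ℕ) → G := fun x => φ fun i => (x i : ℤ)
  have hq : ∀ x y, q y - q x = φ fun i => (y i : ℤ) - x i := fun x y => (map_sub φ _ _).symm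
  obtain ⟨r, hr⟩ := nndist_le_of_mem_finite (S := φ '' {w | ∀ i, w i ∈ ({0, 1} : Set ℤ)})
    ((Set.Finite.pi' fun _ => Set.toFinite _).image _)
  -- Here `r` bounds the distance from the lowest vertex of a unit cube to its other vertices.
  -- Separation above `2 * r` keeps the `r`-thickenings of distinct sets of one colour disjoint.
  obtain ⟨𝒰, hcov, ⟨R, hR⟩, hdisc⟩ := asdimLE_iff.1 h (r + r + 1)
  -- The side `N` exceeds the coordinate spread of every thickened set, so none meets two opposite
  -- faces.
  obtain ⟨N, hN0, hN⟩ := exists_natAbs_lt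
    ((finite_closedBall (0 : G) (r + (R + r) : ℝ≥0)).preimage hφ.injOn)
  let thick : Set G → Set (Fin n → ℕ) := fun U => {x | ∃ u ∈ U, nndist u (q x) ≤ r}
  have hthick : ∀ i, ∀ U ∈ 𝒰 i, ∀ x ∈ thick U, ∀ y ∈ thick U, ∀ j, ((y j : ℤ) - x j).natAbs < N := by
    rintro i U hU x ⟨u, hu, hux⟩ y ⟨v, hv, hvy⟩
    refine hN _ ?_
    rw [Set.mem_preimage, ← hq, Metric.mem_closedBall, dist_comm, ← dist_eq_dist_zero_sub,
      ← coe_nndist, NNReal.coe_le_coe]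
    refine (nndist_triangle _ u _).trans (add_le_add (by rwa [nndist_comm]) ?_)
    exact (nndist_triangle _ v _).trans (add_le_add (hR i U hU u hu v hv) hvy)
  have hdisj : ∀ i, ∀ U ∈ 𝒰 i, ∀ V ∈ 𝒰 i, ∀ x ∈ thick U, x ∈ thick V → U = V := by
    rintro i U hU V hV x ⟨u, hu, hux⟩ ⟨v, hv, hvx⟩
    by_contra hne
    have h1 := hdisc i U hU V hV hne u hu v hv
    have h2 := (nndist_triangle u (q x) v).trans
      (add_le_add hux ((nndist_comm _ _).trans_le hvx))
    exact absurd (h1.trans h2) (by simp)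
  -- The label of direction `i` marks the face `x i = 0` and the thickened sets of colour `i` that
  -- touch it; directions beyond the colours retain only the face.
  let P : Fin n → (Fin n → ℕ) → Prop := fun i x => x i = 0 ∨ ∃ hi : (i : ℕ) < m + 1,
    ∃ U ∈ 𝒰 ⟨i, hi⟩, x ∈ thick U ∧ ∃ y ∈ thick U, y i = 0
  have hPN : ∀ i x, x i = N → ¬ P i x := by
    rintro i x hx (h0 | ⟨hi, U, hU, hxU, y, hyU, hy0⟩)
    · omega
    · have := hthick _ U hU x hxU y hyU i
      omega
  obtain ⟨v, hv, hne⟩ := exists_unitCube_forall_not_const (fun i x => if P i x then 0 else 1) N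
    (fun i x hx => if_pos (Or.inl hx)) (fun i x hx => if_neg (hPN i x hx))
  obtain ⟨c, U, hU, hvU⟩ := hcov (q v)
  have hc : (c : ℕ) < n := by omega
  refine hne ⟨c, hc⟩ ?_
  have hcube : ∀ x : Fin n → ℕ, (∀ j, x j = v j ∨ x j = v j + 1) → x ∈ thick U := by
    intro x hx
    refine ⟨q v, hvU, hr _ _ ?_⟩
    rw [hq]
    refine ⟨_, fun j => ?_, rfl⟩
    rcases hx j with h | h <;> simp [h]
  have hP : ∀ x ∈ thick U, P ⟨c, hc⟩ x ↔ ∃ y ∈ thick U, y ⟨c, hc⟩ = 0 := by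
    intro x hx
    constructor
    · rintro (h0 | ⟨_, V, hV, hxV, h0⟩)
      · exact ⟨x, hx, h0⟩
      · rwa [hdisj c U hU V hV x hx hxV]
    · exact fun h0 => Or.inr ⟨c.2, U, hU, hx, h0⟩
  intro x y hx hy
  simp only [hP x (hcube x hx), hP y (hcube y hy)]

theorem torsionFreeRank_le_asdim : torsionFreeRank G ≤ asdim G := by
  refine iSup₂_le fun n hn => le_iInf₂ fun m hm => ?_
  obtain ⟨S, ⟨e⟩⟩ := hn
  exact_mod_cast le_of_asdimLE (S.subtype.comp e.toAddMonoidHom)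
    (Subtype.val_injective.comp e.injective) hm

end LowerBound

/-! ### Rank bounds asymptotic dimension from above. -/

section UpperBound

/-- The `j`-th of `n + 1` shifted grids of cubes of side `(n + 1) * D` with gaps `D` covers
the point `x`. -/
def inGrid {k : ℕ} (D n j : ℕ) (x : Fin k → ℤ) : Prop :=
  ∀ i, (D : ℤ) ≤ (x i + j * D) % ((n + 1) * D)

theorem exists_inGrid {k n D : ℕ} (hk : k ≤ n) (hD : 0 < D) (x : Fin k → ℤ) :
    ∃ j : Fin (n + 1), inGrid D n j x := by
  by_contra! h
  simp only [inGrid, not_forall, not_le] at h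
  choose i hi using h
  -- If `x` misses every grid, each shift `j` has a coordinate that falls in its gap. The gaps of
  -- different shifts are disjoint modulo `(n + 1) * D`, so these coordinates differ, but there are
  -- only `k ≤ n` of them.
  have hinj : Function.Injective i := by
    intro a b hab
    have ha := hi a
    have hb := hi b
    rw [← hab] at hb
    have hDz : (0 : ℤ) < D := by exact_mod_cast hD
    set N : ℤ := (n + 1) * D with hN
    have hN0 : 0 < N := by positivity
    have ea := Int.emod_add_mul_ediv (x (i a) + (a : ℕ) * D) N
    have eb := Int.emod_add_mul_ediv (x (i a) + (b : ℕ) * D) N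
    have ra := Int.emod_nonneg (x (i a) + (a : ℕ) * D) hN0.ne'
    have rb := Int.emod_nonneg (x (i a) + (b : ℕ) * D) hN0.ne'
    set qa := (x (i a) + (a : ℕ) * D) / N
    set qb := (x (i a) + (b : ℕ) * D) / N
    set sa := (x (i a) + (a : ℕ) * D) % N
    set sb := (x (i a) + (b : ℕ) * D) % N
    have e : ((a : ℕ) - (b : ℕ) - (n + 1) * (qa - qb) : ℤ) * D = sa - sb := by
      rw [hN] at ea eb
      linear_combination eb - ea
    have hz : ((a : ℕ) - (b : ℕ) - (n + 1) * (qa - qb) : ℤ) = 0 := by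
      have h1 : ((a : ℕ) - (b : ℕ) - (n + 1) * (qa - qb) : ℤ) < 1 := by
        by_contra! h1
        nlinarith
      have h2 : (-1 : ℤ) < ((a : ℕ) - (b : ℕ) - (n + 1) * (qa - qb) : ℤ) := by
        by_contra! h2
        nlinarith
      omega
    have ha' := a.2
    have hb' := b.2
    have hq : qa - qb = 0 := by
      have h1 : qa - qb < 1 := by
        by_contra! h1
        have : ((n : ℤ) + 1) * 1 ≤ (n + 1) * (qa - qb) := by gcongr
        omega
      have h2 : -1 < qa - qb := by
        by_contra! h2
        have : ((n : ℤ) + 1) * (qa - qb) ≤ (n + 1) * (-1) := by gcongr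
        omega
      omega
    rw [hq] at hz
    exact Fin.ext (by omega)
  have := Fintype.card_le_of_injective i hinj
  simp at this
  omega

theorem ediv_eq_of_natAbs_lt {k n D j : ℕ} (hD : 0 < D) {x y : Fin k → ℤ} (hx : inGrid D n j x)
    (hy : inGrid D n j y) (h : ∀ i, (y i - x i).natAbs < D) (i : Fin k) :
    (x i + j * D) / ((n + 1) * D) = (y i + j * D) / ((n + 1) * D) := by
  have hx := hx i
  have hy := hy i
  have h := h i
  have hDz : (0 : ℤ) < D := by exact_mod_cast hD
  set N : ℤ := (n + 1) * D with hN
  have hN0 : 0 < N := by positivity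
  have ea := Int.emod_add_mul_ediv (x i + j * D) N
  have eb := Int.emod_add_mul_ediv (y i + j * D) N
  have ra := Int.emod_lt_of_pos (x i + j * D) hN0
  have rb := Int.emod_lt_of_pos (y i + j * D) hN0
  set qa := (x i + j * D) / N
  set qb := (y i + j * D) / N
  have e : N * (qa - qb) < N := by
    have : N * (qa - qb) = N * qa - N * qb := mul_sub _ _ _
    omega
  have e' : N * (qb - qa) < N := by
    have : N * (qb - qa) = N * qb - N * qa := mul_sub _ _ _
    omega
  have h1 : qa - qb < 1 := by
    by_contra! h1
    nlinarith
  have h2 : qb - qa < 1 := by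
    by_contra! h2
    nlinarith
  omega

theorem natAbs_lt_of_ediv_eq {k n D j : ℕ} (hD : 0 < D) {x y : Fin k → ℤ} (i : Fin k)
    (h : (x i + j * D) / ((n + 1) * D) = (y i + j * D) / ((n + 1) * D)) :
    (y i - x i).natAbs < (n + 1) * D := by
  have hDz : (0 : ℤ) < D := by exact_mod_cast hD
  set N : ℤ := (n + 1) * D with hN
  have hN0 : 0 < N := by positivity
  have ea := Int.emod_add_mul_ediv (x i + j * D) N
  have eb := Int.emod_add_mul_ediv (y i + j * D) N
  have ra := Int.emod_lt_of_pos (x i + j * D) hN0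
  have rb := Int.emod_lt_of_pos (y i + j * D) hN0
  have ra' := Int.emod_nonneg (x i + j * D) hN0.ne'
  have rb' := Int.emod_nonneg (y i + j * D) hN0.ne'
  rw [h] at ea
  zify
  rw [abs_lt, ← hN]
  constructor <;> linarith

/-- A finitely generated abelian group maps to some `ℤ ^ k` with finite kernel, where `ℤ ^ k`
embeds into the group. -/
theorem exists_hom_finite_ker (F : Type*) [AddCommGroup F] [AddGroup.FG F] :
    ∃ (k : ℕ) (p : F →+ (Fin k → ℤ)) (s : (Fin k → ℤ) →+ F), Function.Injective s ∧
      (p.ker : Set F).Finite := by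
  have : Module.Finite ℤ F := Module.Finite.iff_addGroup_fg.2 inferInstance
  let T := Submodule.torsion ℤ F
  obtain ⟨s, hs⟩ := Module.projective_lifting_property T.mkQ LinearMap.id T.mkQ_surjective
  let e := (Module.finBasis ℤ (F ⧸ T)).equivFun
  refine ⟨_, (e.toLinearMap ∘ₗ T.mkQ).toAddMonoidHom, (s ∘ₗ e.symm.toLinearMap).toAddMonoidHom,
    ?_, ?_⟩
  · have : Function.Injective s := fun a b hab => by
      have := congrArg T.mkQ hab
      simpa [← LinearMap.comp_apply, hs] using this
    exact this.comp e.symm.injective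
  · have hT : Finite T := Module.finite_of_fg_torsion T (Submodule.torsion_isTorsion)
    refine Set.Finite.subset (Set.toFinite (T : Set F)) fun x hx => ?_
    have hx' : e (T.mkQ x) = 0 := hx
    simpa using hx'

variable {G : Type*} [AddCommGroup G] [MetricSpace G] [IsIsometricVAdd G G] [Countable G]
  [ProperSpace G]

/-- Points at distance at most `D` lie in one coset of the subgroup generated by the `D`-ball. It
thus suffices to cover each coset, through its coordinates in `ℤ ^ k`, by the cells of the shifted
grids, with bounds uniform over the cosets. -/
theorem asdimLE_of_torsionFreeRank_le {n : ℕ} (hn : torsionFreeRank G ≤ n) : AsdimLE G n := by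
  rw [asdimLE_iff]
  intro D
  let F := AddSubgroup.closure (Metric.closedBall (0 : G) D)
  have hfin := (finite_closedBall (0 : G) D).to_subtype
  have hFG : AddGroup.FG F := AddGroup.closure_finite_fg _
  obtain ⟨k, p, s, hs, hp⟩ := exists_hom_finite_ker F
  have hk : k ≤ n := by
    let f : (Fin k → ℤ) →+ G := F.subtype.comp s
    have hf : Function.Injective f := Subtype.val_injective.comp hs
    have : (k : ℕ∞) ≤ torsionFreeRank G :=
      le_iSup₂ (f := fun (n : ℕ) (_ : ∃ S : AddSubgroup G, Nonempty ((Fin n → ℤ) ≃+ S)) =>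
        (n : ℕ∞)) k ⟨f.range, ⟨AddMonoidHom.ofInjective hf⟩⟩
    exact_mod_cast this.trans hn
  have hball : ∀ x y : G, nndist x y ≤ D → y - x ∈ F := fun x y h => by
    refine AddSubgroup.subset_closure ?_
    rw [Metric.mem_closedBall, dist_comm, ← dist_eq_dist_zero_sub]
    exact_mod_cast h
  -- A step of length at most `D` changes every coordinate by less than `E`, so gaps of width `E`
  -- separate the cells.
  obtain ⟨E, hE0, hE⟩ := exists_natAbs_lt (S := p '' {x | nndist 0 (x : G) ≤ D}) (by
    refine Set.Finite.image _ (((finite_closedBall (0 : G) D).preimage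
      Subtype.val_injective.injOn).subset fun x hx => ?_)
    rw [Set.mem_preimage, Metric.mem_closedBall, dist_comm]
    exact_mod_cast hx)
  let ρ : G → G := fun x => Quotient.out (x : G ⧸ F)
  have hρ : ∀ x, x - ρ x ∈ F := fun x => by
    rw [← QuotientAddGroup.eq_iff_sub_mem]
    exact (Quotient.out_eq _).symm
  let z : G → Fin k → ℤ := fun x => p ⟨x - ρ x, hρ x⟩
  have hz : ∀ x y, ρ x = ρ y → ∃ h : y - x ∈ F, z y - z x = p ⟨y - x, h⟩ := by
    intro x y h
    have hxy : y - x = (y - ρ y) - (x - ρ x) := by rw [h]; abel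
    have hmem : y - x ∈ F := hxy ▸ sub_mem (hρ y) (hρ x)
    refine ⟨hmem, ?_⟩
    rw [← map_sub]
    congr 1
    exact Subtype.ext hxy.symm
  let N : ℤ := (n + 1) * E
  let cell : Fin (n + 1) → G → (Fin k → ℤ) → Set G := fun j g w =>
    {x | ρ x = g ∧ inGrid E n j (z x) ∧ ∀ i, (z x i + j * E) / ((n + 1) * E) = w i}
  obtain ⟨R, hR⟩ := nndist_le_of_mem_finite
    (S := Subtype.val '' (p ⁻¹' {w | ∀ i, w i ∈ Set.Ioo (-N) N}))
    (by
      refine Set.Finite.image _ ?_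
      refine Set.Finite.preimage' (Set.Finite.pi' fun _ => Set.finite_Ioo _ _) fun b _ => ?_
      by_cases hb : ∃ x, p x = b
      · obtain ⟨x, rfl⟩ := hb
        refine (hp.image (fun y => y + x)).subset fun y hy => ⟨y - x, ?_, by simp⟩
        have hy' : p y = p x := hy
        simp [hy']
      · convert Set.finite_empty
        ext y
        simpa using fun hy => hb ⟨y, hy⟩)
  refine ⟨fun j => {U | ∃ g w, U = cell j g w}, fun x => ?_, ⟨R, ?_⟩, ?_⟩
  · obtain ⟨j, hj⟩ := exists_inGrid hk hE0 (z x)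
    exact ⟨j, _, ⟨ρ x, _, rfl⟩, rfl, hj, fun i => rfl⟩
  · rintro j _ ⟨g, w, rfl⟩ x ⟨hx1, hx2, hx3⟩ y ⟨hy1, hy2, hy3⟩
    obtain ⟨hmem, heq⟩ := hz x y (hx1.trans hy1.symm)
    refine hR x y ⟨⟨y - x, hmem⟩, fun i => ?_, rfl⟩
    rw [← heq]
    have := natAbs_lt_of_ediv_eq (x := z x) (y := z y) hE0 i ((hx3 i).trans (hy3 i).symm)
    zify at this
    exact abs_lt.1 this
  · rintro j _ ⟨g, w, rfl⟩ _ ⟨g', w', rfl⟩ hne x ⟨hx1, hx2, hx3⟩ y ⟨hy1, hy2, hy3⟩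
    by_contra! hlt
    have hF := hball x y hlt.le
    have hρxy : ρ x = ρ y := by
      have : (y : G ⧸ F) = x := QuotientAddGroup.eq_iff_sub_mem.2 hF
      simp only [ρ, this]
    obtain ⟨hmem, heq⟩ := hz x y hρxy
    refine hne ?_
    have hw : w = w' := by
      ext i
      rw [← hx3 i, ← hy3 i]
      refine ediv_eq_of_natAbs_lt hE0 hx2 hy2 (fun i => ?_) i
      rw [← Pi.sub_apply, heq]
      refine hE _ ⟨_, ?_, rfl⟩ i
      have : dist x y ≤ D := by exact_mod_cast hlt.le
      rw [dist_eq_dist_zero_sub] at this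
      exact_mod_cast this
    rw [← hx1, ← hy1, hρxy, hw]

theorem asdim_eq_torsionFreeRank : asdim G = torsionFreeRank G := by
  refine le_antisymm ?_ torsionFreeRank_le_asdim
  rcases eq_or_ne (torsionFreeRank G) ⊤ with h | h
  · rw [h]; exact le_top
  · obtain ⟨n, hn⟩ := ENat.ne_top_iff_exists.1 h
    rw [← hn]
    exact iInf₂_le n (asdimLE_of_torsionFreeRank_le hn.ge)

end UpperBound

/-! ### Controlled sections over torsion quotients. -/

section Torsion

theorem finite_closure_of_isAddTorsion {Q : Type*} [AddCommGroup Q] (hQ : IsAddTorsion Q)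
    {S : Set Q} (hS : S.Finite) : (AddSubgroup.closure S : Set Q).Finite := by
  have := hS.to_subtype
  have : AddGroup.FG (AddSubgroup.closure S) := AddGroup.closure_finite_fg _
  have : Finite (AddSubgroup.closure S) := AddCommGroup.finite_of_fg_isAddTorsion _
    (hQ.addSubgroup _)
  exact Set.toFinite _

theorem exists_exhaustion {Q : Type*} [AddCommGroup Q] [Countable Q] (hQ : IsAddTorsion Q) :
    ∃ K : ℕ → AddSubgroup Q, Monotone K ∧ K 0 = ⊥ ∧ (∀ n, (K n : Set Q).Finite) ∧
      ∀ x, ∃ n, x ∈ K n := by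
  obtain ⟨e, he⟩ := exists_surjective_nat Q
  refine ⟨fun n => AddSubgroup.closure (e '' Set.Iio n), fun m n hmn => ?_, by simp, fun n => ?_,
    fun x => ?_⟩
  · exact AddSubgroup.closure_mono (Set.image_mono (Set.Iio_subset_Iio hmn))
  · exact finite_closure_of_isAddTorsion hQ ((Set.finite_Iio n).image e)
  · obtain ⟨n, rfl⟩ := he x
    exact ⟨n + 1, AddSubgroup.subset_closure ⟨n, by simp, rfl⟩⟩

theorem exists_coset_representatives {Q : Type*} [AddCommGroup Q] (K : AddSubgroup Q) :
    ∃ ρ : Q → Q, (∀ x, x - ρ x ∈ K) ∧ (∀ x y, x - y ∈ K → ρ x = ρ y) ∧ ∀ x ∈ K, ρ x = 0 := by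
  let σ : Q → Q := fun x => Quotient.out (x : Q ⧸ K)
  have hσ : ∀ x, x - σ x ∈ K := fun x => by
    rw [← QuotientAddGroup.eq_iff_sub_mem]
    exact (Quotient.out_eq _).symm
  have hσ' : ∀ x y, x - y ∈ K → σ x = σ y := fun x y h => by
    have : (x : Q ⧸ K) = y := QuotientAddGroup.eq_iff_sub_mem.2 h
    simp only [σ, this]
  refine ⟨fun x => σ x - σ 0, fun x => ?_, fun x y h => by simp only [hσ' x y h], fun x hx => ?_⟩
  · change x - (σ x - σ 0) ∈ K
    rw [show x - (σ x - σ 0) = (x - σ x) - (0 - σ 0) by abel]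
    exact sub_mem (hσ x) (hσ 0)
  · change σ x - σ 0 = 0
    rw [hσ' x 0 (by simpa using hx), sub_self]

/-- A section of a homomorphism onto a countable torsion group which is, up to finite sets,
a bornologous map. -/
theorem exists_finBornologous_section {G Q : Type*} [AddCommGroup G] [AddCommGroup Q] [Countable Q]
    (hQ : IsAddTorsion Q) (π : G →+ Q) (hπ : Function.Surjective π) :
    ∃ s : Q → G, (∀ x, π (s x) = x) ∧ FinBornologous s := by
  obtain ⟨K, hmono, h0, hfin, hex⟩ := exists_exhaustion hQ
  choose ρ hρ hρeq hρ0 using fun n => exists_coset_representatives (K n)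
  obtain ⟨σ, hσ⟩ := hπ.hasRightInverse
  let σ' : Q → G := fun x => σ x - σ 0
  have hσ' : ∀ x, π (σ' x) = x := fun x => by simp [σ', hσ x, hσ 0]
  choose N hN using hex
  -- The section lifts the telescoping expansion of `x` term by term. Terms vanish once `x ∈ K j`,
  -- since `ρ` and `σ'` are normalised at `0`. If `y - x ∈ K n`, the terms from `n` on agree for `x`
  -- and `y`, and the earlier ones take finitely many values.
  let d : ℕ → Q → Q := fun j x => ρ j x - ρ (j + 1) x
  have hd : ∀ j x, d j x ∈ K (j + 1) := fun j x => by
    have := sub_mem (hρ (j + 1) x) (hmono j.le_succ (hρ j x))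
    convert this using 1
    simp [d]
  let sum : ℕ → Q → G := fun n x => ∑ j ∈ Finset.range n, σ' (d j x)
  have hsum : ∀ n x, x ∈ K n → ∀ m ≥ n, sum m x = sum n x := by
    intro n x hx m hm
    refine (Finset.sum_subset (Finset.range_subset_range.2 hm) fun j _ hj => ?_).symm
    have hj : n ≤ j := by simpa using hj
    simp [d, σ', hρ0 j x (hmono hj hx), hρ0 (j + 1) x (hmono (hj.trans j.le_succ) hx)]
  refine ⟨fun x => sum (N x) x, fun x => ?_, fun S hS => ?_⟩
  · have hsum0 : ∀ n, π (sum n x) = x - ρ n x := by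
      intro n
      induction n with
      | zero =>
        have := hρ 0 x
        rw [h0, AddSubgroup.mem_bot] at this
        simp [sum, this]
      | succ n ih =>
        simp only [sum, Finset.sum_range_succ, map_add] at ih ⊢
        rw [ih, hσ']
        simp [d]
    rw [hsum0, hρ0 _ _ (hN x), sub_zero]
  · obtain ⟨n, hn⟩ := (hS.image N).bddAbove
    have hSn : ∀ b ∈ S, b ∈ K n := fun b hb => hmono (hn ⟨b, hb, rfl⟩) (hN b)
    let B : Set G := Set.range fun f : Fin n → K n => ∑ j, σ' (f j)
    have := (hfin n).to_subtype
    refine ⟨Set.image2 (· - ·) B B, (Set.finite_range _).image2 _ (Set.finite_range _), ?_⟩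
    have hB : ∀ x, sum n x ∈ B := fun x =>
      ⟨fun j => ⟨d j x, hmono j.2 (hd j x)⟩, by simp [sum, Finset.sum_range]⟩
    intro x y hxy
    refine ⟨_, hB y, _, hB x, ?_⟩
    let M := max n (max (N x) (N y))
    dsimp only
    rw [← hsum (N x) x (hN x) M (by simp [M]), ← hsum (N y) y (hN y) M (by simp [M])]
    have htail : ∀ z, sum M z = sum n z + ∑ j ∈ Finset.Ico n M, σ' (d j z) := fun z =>
      (Finset.sum_range_add_sum_Ico _ (le_max_left _ _)).symm
    rw [htail x, htail y]
    have : ∑ j ∈ Finset.Ico n M, σ' (d j x) = ∑ j ∈ Finset.Ico n M, σ' (d j y) := by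
      refine Finset.sum_congr rfl fun j hj => ?_
      have hj := (Finset.mem_Ico.1 hj).1
      simp only [d]
      rw [hρeq j y x (hmono hj (hSn _ hxy)),
        hρeq (j + 1) y x (hmono (hj.trans j.le_succ) (hSn _ hxy))]
    rw [this]
    abel

/-- A section `s` splits `G` as a set by `x ↦ (x - s x, x)`; control of `s` gives control of this
bijection and of its inverse. -/
theorem FinEquiv.prod_quotient {G : Type*} [AddCommGroup G] [Countable G] (F : AddSubgroup G)
    (hF : IsAddTorsion (G ⧸ F)) : FinEquiv G (F × (G ⧸ F)) := by
  have : Countable (G ⧸ F) := (QuotientAddGroup.mk'_surjective F).countable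
  obtain ⟨s, hs, hsb⟩ := exists_finBornologous_section hF (QuotientAddGroup.mk' F)
    (QuotientAddGroup.mk'_surjective F)
  have hmem : ∀ x : G, x - s x ∈ F := fun x => by
    rw [← QuotientAddGroup.eq_iff_sub_mem]
    exact (hs (x : G ⧸ F)).symm
  refine ⟨fun x => (⟨x - s x, hmem x⟩, x), fun p => p.1 + s p.2, ?_, ?_,
    ⟨{0}, Set.finite_singleton _, fun x => by simp⟩,
    ⟨{0}, Set.finite_singleton _, fun p => ?_⟩⟩
  · intro S hS
    obtain ⟨T, hT, h⟩ := hsb _ (hS.image (QuotientAddGroup.mk : G → G ⧸ F))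
    refine ⟨(Subtype.val ⁻¹' Set.image2 (· - ·) S T) ×ˢ (QuotientAddGroup.mk '' S),
      ((hS.image2 _ hT).preimage Subtype.val_injective.injOn).prod (hS.image _), ?_⟩
    intro x y hxy
    refine ⟨⟨y - x, hxy, s y - s x, h _ _ ⟨_, hxy, rfl⟩, ?_⟩, _, hxy, rfl⟩
    simp only [Prod.fst_sub, AddSubgroup.coe_sub]
    abel
  · intro S hS
    obtain ⟨T, hT, h⟩ := hsb _ (hS.image Prod.snd)
    refine ⟨Set.image2 (· + ·) ((fun p => (p.1 : G)) '' S) T, (hS.image _).image2 _ hT, ?_⟩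
    intro p q hpq
    refine ⟨_, ⟨_, hpq, rfl⟩, _, h _ _ ⟨_, hpq, rfl⟩, ?_⟩
    simp only [Prod.fst_sub, AddSubgroup.coe_sub]
    abel
  · have hp : ((p.1 + s p.2 : G) : G ⧸ F) = p.2 := by
      have h1 : ((p.1 : G) : G ⧸ F) = 0 := (QuotientAddGroup.eq_zero_iff _).2 p.1.2
      have h2 : ((s p.2 : G) : G ⧸ F) = p.2 := hs _
      rw [QuotientAddGroup.mk_add, h1, h2, zero_add]
    rw [Set.mem_singleton_iff, sub_eq_zero]
    ext
    · simp [hp]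
    · exact hp

end Torsion

/-! ### Balanced distributions of finite sets. -/

section Balanced

/-- Enumerating `S` and reducing indices modulo `R.card` gives fibres of size the floor or the
ceiling of the quotient of the cardinalities. -/
theorem exists_balanced_map {α β : Type*} [DecidableEq β] (S : Finset α) {R : Finset β}
    (hR : R.Nonempty) :
    ∃ ψ : α → β, (∀ x ∈ S, ψ x ∈ R) ∧ ∀ a b, a * R.card ≤ S.card → S.card ≤ b * R.card →
      ∀ r ∈ R, a ≤ (S.filter (ψ · = r)).card ∧ (S.filter (ψ · = r)).card ≤ b := by
  classical
  have hr : 0 < R.card := hR.card_pos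
  let ψ : α → β := fun x => if h : x ∈ S then
    (R.equivFin.symm ⟨(S.equivFin ⟨x, h⟩ : ℕ) % R.card, Nat.mod_lt _ hr⟩ : β) else hR.choose
  refine ⟨ψ, fun x hx => by simp [ψ, hx], fun a b ha hb r hrR => ?_⟩
  have hcard : (S.filter (ψ · = r)).card =
      ((Finset.range S.card).filter (· ≡ R.equivFin ⟨r, hrR⟩ [MOD R.card])).card := by
    refine Finset.card_bij (fun x hx => (S.equivFin ⟨x, (Finset.mem_filter.1 hx).1⟩ : ℕ)) ?_ ?_ ?_
    · intro x hx
      obtain ⟨hxS, hxr⟩ := Finset.mem_filter.1 hx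
      simp only [ψ, hxS, dif_pos] at hxr
      simp only [Finset.mem_filter, Finset.mem_range, Fin.is_lt, true_and]
      have : R.equivFin.symm ⟨(S.equivFin ⟨x, hxS⟩ : ℕ) % R.card, Nat.mod_lt _ hr⟩ = ⟨r, hrR⟩ :=
        Subtype.ext hxr
      rw [Equiv.symm_apply_eq] at this
      rw [← this]
      exact (Nat.mod_modEq _ _).symm
    · intro x hx y hy h
      simpa using S.equivFin.injective (Fin.ext h)
    · intro i hi
      simp only [Finset.mem_filter, Finset.mem_range] at hi
      refine ⟨S.equivFin.symm ⟨i, hi.1⟩, ?_, by simp⟩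
      simp only [Finset.mem_filter, Finset.coe_mem, true_and, ψ, dif_pos, Subtype.coe_eta,
        Equiv.apply_symm_apply]
      have : (⟨i % R.card, Nat.mod_lt _ hr⟩ : Fin R.card) = R.equivFin ⟨r, hrR⟩ := by
        refine Fin.ext ?_
        have := hi.2
        rw [Nat.ModEq, Nat.mod_eq_of_lt (Fin.is_lt _)] at this
        exact this
      rw [this]
      simp
  rw [hcard, ← Nat.count_eq_card_filter_range, Nat.count_modEq_card _ hr]
  have h1 : a ≤ S.card / R.card := (Nat.le_div_iff_mul_le hr).2 ha
  refine ⟨h1.trans (Nat.le_add_right _ _), ?_⟩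
  split_ifs with h
  · have : S.card / R.card < b := by
      by_contra! hlt
      have h2 := Nat.div_add_mod S.card R.card
      have h3 : b * R.card ≤ R.card * (S.card / R.card) := by
        rw [mul_comm]; exact Nat.mul_le_mul_left _ hlt
      omega
    omega
  · exact Nat.div_le_of_le_mul (by rwa [mul_comm])

/-- A set `B` fibred over `P` with all fibres of size `l` can be mapped to a set `C` of suitable
size so that all fibres have size `a` or `a + 1` and lie over single points of `P`. -/
theorem exists_balanced_map_over {α β γ : Type*} [DecidableEq β] [DecidableEq γ] (π : α → β)
    {P : Finset β} {B : Finset α} {C : Finset γ} {a l p : ℕ} (hP : P.Nonempty) (hp : 0 < p)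
    (hB : ∀ b ∈ B, π b ∈ P) (hl : ∀ q ∈ P, (B.filter (π · = q)).card = l)
    (h1 : a * (p + 1) ≤ l) (h2 : l ≤ (a + 1) * p) (h3 : p * P.card ≤ C.card)
    (h4 : C.card ≤ (p + 1) * P.card) :
    ∃ ψ : α → γ, (∀ b ∈ B, ψ b ∈ C) ∧
      (∀ c ∈ C, a ≤ (B.filter (ψ · = c)).card ∧ (B.filter (ψ · = c)).card ≤ a + 1) ∧
      ∀ b ∈ B, ∀ b' ∈ B, ψ b = ψ b' → π b = π b' := by
  -- First `C` is spread over `P`, with fibres of size `p` or `p + 1`; then each fibre of `B` is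
  -- spread over the fibre of `C` above the same point.
  obtain ⟨χ, hχ, hχc⟩ := exists_balanced_map C hP
  have hχc := hχc _ _ h3 h4
  have : Nonempty γ := by
    obtain ⟨q, hq⟩ := hP
    obtain ⟨c, -⟩ := Finset.card_pos.1 (hp.trans_le (hχc q hq).1)
    exact ⟨c⟩
  have hne : ∀ q ∈ P, (C.filter (χ · = q)).Nonempty := fun q hq =>
    Finset.card_pos.1 (hp.trans_le (hχc q hq).1)
  choose! ψ hψ hψc using fun q hq => exists_balanced_map (B.filter (π · = q)) (hne q hq)
  have hmem : ∀ b ∈ B, ψ (π b) b ∈ C ∧ χ (ψ (π b) b) = π b := fun b hb =>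
    Finset.mem_filter.1 (hψ (π b) (hB b hb) b (Finset.mem_filter.2 ⟨hb, rfl⟩))
  refine ⟨fun b => ψ (π b) b, fun b hb => (hmem b hb).1, fun c hc => ?_, fun b hb b' hb' h => ?_⟩
  · have hcP := hχ c hc
    have : B.filter (fun b => ψ (π b) b = c) = (B.filter (π · = χ c)).filter (ψ (χ c) · = c) := by
      ext b
      simp only [Finset.mem_filter]
      constructor
      · rintro ⟨hb, rfl⟩
        have h := (hmem b hb).2
        exact ⟨⟨hb, h.symm⟩, by rw [h]⟩
      · rintro ⟨⟨hb, h⟩, h'⟩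
        exact ⟨hb, by rw [h, h']⟩
    rw [this]
    refine hψc (χ c) hcP a (a + 1) ?_ ?_ c (Finset.mem_filter.2 ⟨hc, rfl⟩)
    · rw [hl _ hcP]
      exact (Nat.mul_le_mul_left _ (hχc _ hcP).2).trans h1
    · rw [hl _ hcP]
      exact h2.trans (Nat.mul_le_mul_left _ (hχc _ hcP).1)
  · rw [← (hmem b hb).2, ← (hmem b' hb').2]
    exact congrArg χ h

theorem exists_preimage_finset {A B : Type*} [AddCommGroup A] [AddCommGroup B] [DecidableEq B]
    (f : A →+ B) (hf : Function.Surjective f) (hker : (f.ker : Set A).Finite) (P : Finset B) :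
    ∃ S : Finset A, (∀ a, a ∈ S ↔ f a ∈ P) ∧
      ∀ p ∈ P, (S.filter (f · = p)).card = Nat.card f.ker := by
  have hfib : ∀ a₀, (f ⁻¹' {f a₀}) = (fun k => k + a₀) '' (f.ker : Set A) := by
    intro a₀
    ext a
    simp only [Set.mem_preimage, Set.mem_singleton_iff, Set.mem_image, SetLike.mem_coe,
      AddMonoidHom.mem_ker]
    constructor
    · exact fun h => ⟨a - a₀, by simp [h], by simp⟩
    · rintro ⟨k, hk, rfl⟩; simp [hk]
  have hfin : (f ⁻¹' (P : Set B)).Finite := by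
    refine Set.Finite.preimage' P.finite_toSet fun b _ => ?_
    obtain ⟨a₀, rfl⟩ := hf b
    rw [hfib]
    exact hker.image _
  refine ⟨hfin.toFinset, fun a => by simp, fun p hp => ?_⟩
  obtain ⟨a₀, rfl⟩ := hf p
  have : (hfin.toFinset.filter (f · = f a₀) : Set A) = (fun k => k + a₀) '' (f.ker : Set A) := by
    rw [← hfib]
    ext a
    simp only [Finset.coe_filter, Set.Finite.mem_toFinset, Set.mem_preimage, Finset.mem_coe,
      Set.mem_ofPred_eq, Set.mem_singleton_iff]
    exact ⟨fun h => h.2, fun h => ⟨h ▸ hp, h⟩⟩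
  rw [← Set.ncard_coe_finset, this, Set.ncard_image_of_injective _ (add_left_injective a₀)]
  rfl

end Balanced

/-! ### Equivalence of infinite countable torsion groups. -/

section Towers

variable {T H : Type*} [AddCommGroup T] [AddCommGroup H]

/-- The projection between the quotients by two nested subgroups. -/
def quotientProj {K K' : AddSubgroup T} (h : K ≤ K') : T ⧸ K →+ T ⧸ K' :=
  QuotientAddGroup.map K K' (AddMonoidHom.id T) h

@[simp]
theorem quotientProj_mk {K K' : AddSubgroup T} (h : K ≤ K') (x : T) :
    quotientProj h (x : T ⧸ K) = x := rfl

theorem quotientProj_surjective {K K' : AddSubgroup T} (h : K ≤ K') :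
    Function.Surjective (quotientProj h) := fun y => by
  obtain ⟨x, rfl⟩ := QuotientAddGroup.mk_surjective y
  exact ⟨x, rfl⟩

theorem finite_ker_quotientProj {K K' : AddSubgroup T} (h : K ≤ K') (hK' : (K' : Set T).Finite) :
    ((quotientProj h).ker : Set (T ⧸ K)).Finite := by
  refine (hK'.image (QuotientAddGroup.mk : T → T ⧸ K)).subset fun y hy => ?_
  obtain ⟨x, rfl⟩ := QuotientAddGroup.mk_surjective y
  exact ⟨x, (QuotientAddGroup.eq_zero_iff x).1 hy, rfl⟩

theorem infinite_quotient [Infinite T] {K : AddSubgroup T} (hK : (K : Set T).Finite) :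
    Infinite (T ⧸ K) := by
  by_contra hfin
  rw [not_infinite_iff_finite] at hfin
  have := hK.to_subtype
  have : Finite T := Finite.of_equiv _ (AddSubgroup.addGroupEquivQuotientProdAddSubgroup (s := K)).symm
  exact not_finite T

/-- Adjoining `x` and representatives of `N` cosets to `K` keeps the group finitely generated and
torsion, hence finite. -/
theorem exists_large_finite_subgroup [Infinite T] (hT : IsAddTorsion T) {K : AddSubgroup T}
    (hK : (K : Set T).Finite) (x : T) (N : ℕ) :
    ∃ (K' : AddSubgroup T) (h : K ≤ K'), (K' : Set T).Finite ∧ x ∈ K' ∧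
      N ≤ Nat.card (quotientProj h).ker := by
  have := infinite_quotient hK
  obtain ⟨s, hs⟩ := Infinite.exists_subset_card_eq (T ⧸ K) N
  let S : Set T := insert x (K ∪ Quotient.out '' (s : Set (T ⧸ K)))
  have hS : S.Finite := (hK.union (s.finite_toSet.image _)).insert x
  have hKS : K ≤ AddSubgroup.closure S := fun y hy =>
    AddSubgroup.subset_closure (Or.inr (Or.inl hy))
  have hfin := finite_closure_of_isAddTorsion hT hS
  refine ⟨AddSubgroup.closure S, hKS, hfin, AddSubgroup.subset_closure (Or.inl rfl), ?_⟩
  rw [← hs, ← Set.ncard_coe_finset]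
  refine Set.ncard_le_ncard (t := ((quotientProj hKS).ker : Set (T ⧸ K))) (fun y hy => ?_)
    (finite_ker_quotientProj hKS hfin)
  have hy' : ((Quotient.out y : T) : T ⧸ K) = y := Quotient.out_eq y
  rw [SetLike.mem_coe, AddMonoidHom.mem_ker, ← hy', quotientProj_mk,
    QuotientAddGroup.eq_zero_iff]
  exact AddSubgroup.subset_closure (Or.inr (Or.inr ⟨y, hy, rfl⟩))

/-- Exhaustions of two infinite countable torsion groups by finite subgroups whose indices are
compatible. -/
theorem exists_compatible_towers [Countable T] [Infinite T] (hT : IsAddTorsion T) [Countable H]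
    [Infinite H] (hH : IsAddTorsion H) :
    ∃ (K : ℕ → AddSubgroup T) (L : ℕ → AddSubgroup H) (a : ℕ → ℕ), K 0 = ⊥ ∧
      (∀ n, (K n : Set T).Finite) ∧ (∀ n, (L n : Set H).Finite) ∧ (∀ n, 1 ≤ a n) ∧
      (∀ x, ∃ n, x ∈ K n) ∧ (∀ y, ∃ n, y ∈ L n) ∧
      ∀ n, ∃ (hK : K n ≤ K (n + 1)) (hL : L n ≤ L (n + 1)) (p : ℕ), 0 < p ∧
        a n * (p + 1) ≤ Nat.card (quotientProj hL).ker ∧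
        Nat.card (quotientProj hL).ker ≤ (a n + 1) * p ∧
        (a (n + 1) + 1) * p ≤ Nat.card (quotientProj hK).ker ∧
        Nat.card (quotientProj hK).ker ≤ a (n + 1) * (p + 1) := by
  obtain ⟨e, he⟩ := exists_surjective_nat T
  obtain ⟨e', he'⟩ := exists_surjective_nat H
  let St := {q : AddSubgroup T × AddSubgroup H × ℕ //
    (q.1 : Set T).Finite ∧ (q.2.1 : Set H).Finite ∧ 1 ≤ q.2.2}
  have step : ∀ (n : ℕ) (q : St), ∃ q' : St, e n ∈ q'.1.1 ∧ e' n ∈ q'.1.2.1 ∧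
      ∃ (hK : q.1.1 ≤ q'.1.1) (hL : q.1.2.1 ≤ q'.1.2.1) (p : ℕ), 0 < p ∧
        q.1.2.2 * (p + 1) ≤ Nat.card (quotientProj hL).ker ∧
        Nat.card (quotientProj hL).ker ≤ (q.1.2.2 + 1) * p ∧
        (q'.1.2.2 + 1) * p ≤ Nat.card (quotientProj hK).ker ∧
        Nat.card (quotientProj hK).ker ≤ q'.1.2.2 * (p + 1) := by
    rintro n ⟨⟨K, L, a⟩, hK, hL, ha⟩
    dsimp only at hK hL ha ⊢
    -- With `l` this large, rounding `l / (a + 1)` up to `p` still leaves `a * (p + 1) ≤ l`.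
    obtain ⟨L', hLL', hL', hxL', hcL⟩ :=
      exists_large_finite_subgroup hH hL (e' n) (3 * a * (a + 1))
    set l := Nat.card (quotientProj hLL').ker
    let p := l / (a + 1) + 1
    have hp : 0 < p := Nat.succ_pos _
    -- This size makes the next value `m / p - 1` at least `2 * p`, which absorbs the rounding error
    -- in the upper bound for `m`.
    obtain ⟨K', hKK', hK', hxK', hcK⟩ :=
      exists_large_finite_subgroup hT hK (e n) ((2 * p + 1) * p)
    set m := Nat.card (quotientProj hKK').ker with hm
    have hmp : 2 * p + 1 ≤ m / p := (Nat.le_div_iff_mul_le hp).2 hcK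
    refine ⟨⟨⟨K', L', m / p - 1⟩, hK', hL', by dsimp only; omega⟩, hxK', hxL', hKK', hLL', p, hp,
      ?_, ?_, ?_, ?_⟩
    · have h1 : 3 * a ≤ l / (a + 1) := (Nat.le_div_iff_mul_le (Nat.succ_pos a)).2 hcL
      have h2 := Nat.div_mul_le_self l (a + 1)
      change a * (l / (a + 1) + 1 + 1) ≤ l
      nlinarith
    · have := Nat.lt_div_mul_add (a := l) (Nat.succ_pos a)
      change l ≤ (a + 1) * (l / (a + 1) + 1)
      rw [mul_add, mul_one, mul_comm]
      exact this.le
    · change (m / p - 1 + 1) * p ≤ m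
      rw [Nat.sub_add_cancel (by omega)]
      exact Nat.div_mul_le_self m p
    · change m ≤ (m / p - 1) * (p + 1)
      have h1 := Nat.lt_div_mul_add (a := m) hp
      obtain ⟨c, hc⟩ : ∃ c, m / p = c + 1 := ⟨m / p - 1, by omega⟩
      rw [hc] at h1 hmp ⊢
      rw [Nat.add_sub_cancel]
      nlinarith
  choose F hF1 hF2 hF using step
  let s : ℕ → St := fun n => Nat.rec ⟨⟨⊥, ⊥, 1⟩, by simp, by simp, le_rfl⟩ F n
  refine ⟨fun n => (s n).1.1, fun n => (s n).1.2.1, fun n => (s n).1.2.2, rfl,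
    fun n => (s n).2.1, fun n => (s n).2.2.1, fun n => (s n).2.2.2, fun x => ?_, fun y => ?_,
    fun n => hF n (s n)⟩
  · obtain ⟨n, rfl⟩ := he x
    exact ⟨n + 1, hF1 n (s n)⟩
  · obtain ⟨n, rfl⟩ := he' y
    exact ⟨n + 1, hF2 n (s n)⟩

/-- A map from a union `P` of cosets of `L n` onto a coset `t` of `K n` which is compatible with
the lower levels of both towers. -/
structure IsPatchMap (K : ℕ → AddSubgroup T) (L : ℕ → AddSubgroup H) (n : ℕ)
    (P : Finset (H ⧸ L n)) (t : T ⧸ K n) (g : H → T) : Prop where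
  mk_eq : ∀ y : H, (y : H ⧸ L n) ∈ P → (g y : T ⧸ K n) = t
  sub_mem : ∀ y y' : H, (y : H ⧸ L n) ∈ P → (y' : H ⧸ L n) ∈ P → ∀ k ≤ n, y - y' ∈ L k →
    g y - g y' ∈ K k
  mem_of_sub_mem : ∀ y y' : H, (y : H ⧸ L n) ∈ P → (y' : H ⧸ L n) ∈ P → ∀ k < n,
    g y - g y' ∈ K k → y - y' ∈ L (k + 1)
  surj : ∀ x : T, (x : T ⧸ K n) = t → ∃ y : H, (y : H ⧸ L n) ∈ P ∧ g y = x

/-- At level `0` the target coset is a point and the map is constant. For the step, the `L n`-cosets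
inside `P` are distributed evenly over the `K n`-cosets inside `t`, each receiving `a n` or `a n +
1` of them, and patches of level `n` are glued. Each group of cosets lies in a single `L (n +
1)`-coset, whence the index shift in `mem_of_sub_mem`. -/
theorem exists_isPatchMap {K : ℕ → AddSubgroup T} {L : ℕ → AddSubgroup H} {a : ℕ → ℕ}
    (hK0 : K 0 = ⊥) (hK : ∀ n, (K n : Set T).Finite) (hL : ∀ n, (L n : Set H).Finite)
    (ha : ∀ n, 1 ≤ a n)
    (hstep : ∀ n, ∃ (hK : K n ≤ K (n + 1)) (hL : L n ≤ L (n + 1)) (p : ℕ), 0 < p ∧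
        a n * (p + 1) ≤ Nat.card (quotientProj hL).ker ∧
        Nat.card (quotientProj hL).ker ≤ (a n + 1) * p ∧
        (a (n + 1) + 1) * p ≤ Nat.card (quotientProj hK).ker ∧
        Nat.card (quotientProj hK).ker ≤ a (n + 1) * (p + 1))
    (n : ℕ) (P : Finset (H ⧸ L n)) (h1 : a n ≤ P.card) (h2 : P.card ≤ a n + 1) (t : T ⧸ K n) :
    ∃ g, IsPatchMap K L n P t g := by
  classical
  induction n with
  | zero =>
    obtain ⟨x, rfl⟩ := QuotientAddGroup.mk_surjective t
    obtain ⟨q, hq⟩ := Finset.card_pos.1 ((ha 0).trans h1)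
    obtain ⟨y, rfl⟩ := QuotientAddGroup.mk_surjective q
    refine ⟨fun _ => x, fun _ _ => rfl, ?_, ?_, ?_⟩
    · intro _ _ _ _ k _ _
      rw [sub_self]; exact zero_mem _
    · intro _ _ _ _ k hk
      exact absurd hk (Nat.not_lt_zero k)
    · intro x' hx'
      refine ⟨y, hq, ?_⟩
      rw [QuotientAddGroup.eq_iff_sub_mem, hK0, AddSubgroup.mem_bot, sub_eq_zero] at hx'
      exact hx'.symm
  | succ n ih =>
    obtain ⟨hKn, hLn, p, hp, hl1, hl2, hm1, hm2⟩ := hstep n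
    obtain ⟨B, hB, hBc⟩ := exists_preimage_finset (quotientProj hLn) (quotientProj_surjective hLn)
      (finite_ker_quotientProj hLn (hL _)) P
    obtain ⟨C, hC, hCc⟩ := exists_preimage_finset (quotientProj hKn) (quotientProj_surjective hKn)
      (finite_ker_quotientProj hKn (hK _)) {t}
    simp only [Finset.mem_singleton] at hC
    have hCcard : C.card = Nat.card (quotientProj hKn).ker := by
      rw [← hCc t (Finset.mem_singleton_self t), Finset.filter_true_of_mem]
      exact fun c hc => (hC c).1 hc
    obtain ⟨ψ, hψC, hψc, hψ⟩ := exists_balanced_map_over (quotientProj hLn) (P := P) (B := B)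
      (C := C) (Finset.card_pos.1 ((ha _).trans h1)) hp (fun b hb => (hB b).1 hb) hBc hl1 hl2
      (by
        rw [hCcard]
        refine le_trans ?_ hm1
        rw [mul_comm]
        exact Nat.mul_le_mul_right _ h2)
      (by
        rw [hCcard]
        refine hm2.trans ?_
        rw [mul_comm]
        exact Nat.mul_le_mul_left _ h1)
    choose! g hg using fun c hc => ih (B.filter (ψ · = c)) (hψc c hc).1 (hψc c hc).2 c
    have hPB : ∀ y : H, (y : H ⧸ L (n + 1)) ∈ P → (y : H ⧸ L n) ∈ B := fun y hy => (hB _).2 hy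
    have hmem : ∀ y : H, (y : H ⧸ L (n + 1)) ∈ P →
        (y : H ⧸ L n) ∈ B.filter (ψ · = ψ (y : H ⧸ L n)) := fun y hy =>
      Finset.mem_filter.2 ⟨hPB y hy, rfl⟩
    have hgψ : ∀ y : H, (y : H ⧸ L (n + 1)) ∈ P →
        (g (ψ (y : H ⧸ L n)) y : T ⧸ K n) = ψ (y : H ⧸ L n) := fun y hy =>
      (hg _ (hψC _ (hPB y hy))).mk_eq y (hmem y hy)
    have hKmono : Monotone K := monotone_nat_of_le_succ fun n => (hstep n).choose
    have hLmono : Monotone L := monotone_nat_of_le_succ fun n => (hstep n).choose_spec.choose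
    have hmk : ∀ y : H, (y : H ⧸ L (n + 1)) ∈ P →
        (g (ψ (y : H ⧸ L n)) y : T ⧸ K (n + 1)) = t := fun y hy => by
      have := (hC _).1 (hψC _ (hPB y hy))
      rw [← hgψ y hy] at this
      exact this
    refine ⟨fun y => g (ψ (y : H ⧸ L n)) y, hmk, ?_, ?_, ?_⟩
    · intro y y' hy hy' k hk hyy
      rcases hk.lt_or_eq with hk | rfl
      · have hk : k ≤ n := Nat.lt_succ_iff.1 hk
        have : (y : H ⧸ L n) = y' := QuotientAddGroup.eq_iff_sub_mem.2 (hLmono hk hyy)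
        rw [← this]
        exact (hg _ (hψC _ (hPB y hy))).sub_mem y y' (hmem y hy) (this ▸ hmem y hy) k hk hyy
      · rw [← QuotientAddGroup.eq_iff_sub_mem, hmk y hy, hmk y' hy']
    · intro y y' hy hy' k hk hgg
      have hk : k ≤ n := Nat.lt_succ_iff.1 hk
      have hψeq : ψ (y : H ⧸ L n) = ψ (y' : H ⧸ L n) := by
        rw [← hgψ y hy, ← hgψ y' hy']
        exact QuotientAddGroup.eq_iff_sub_mem.2 (hKmono hk hgg)
      rcases hk.lt_or_eq with hk | rfl
      · rw [← hψeq] at hgg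
        exact (hg _ (hψC _ (hPB y hy))).mem_of_sub_mem y y' (hmem y hy)
          (by rw [hψeq]; exact hmem y' hy') k hk hgg
      · have := hψ _ (hPB y hy) _ (hPB y' hy') hψeq
        exact QuotientAddGroup.eq_iff_sub_mem.1 this
    · intro x hx
      have hxC : (x : T ⧸ K n) ∈ C := (hC _).2 hx
      obtain ⟨y, hy, hgy⟩ := (hg _ hxC).surj x rfl
      obtain ⟨hyB, hyψ⟩ := Finset.mem_filter.1 hy
      exact ⟨y, (hB _).1 hyB, by rw [hyψ, hgy]⟩

theorem exists_subset_of_monotone {A : Type*} [AddCommGroup A] {M : ℕ → AddSubgroup A}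
    (hM : Monotone M) (hex : ∀ x, ∃ n, x ∈ M n) {S : Set A} (hS : S.Finite) :
    ∃ k, S ⊆ M k := by
  choose N hN using hex
  obtain ⟨k, hk⟩ := (hS.image N).bddAbove
  exact ⟨k, fun x hx => hM (hk ⟨x, hx, rfl⟩) (hN x)⟩

theorem FinEquiv.of_infinite_torsion [Countable T] [Infinite T] (hT : IsAddTorsion T)
    [Countable H] [Infinite H] (hH : IsAddTorsion H) : FinEquiv H T := by
  classical
  obtain ⟨K, L, a, hK0, hK, hL, ha, hKex, hLex, hstep⟩ := exists_compatible_towers hT hH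
  have hKmono : Monotone K := monotone_nat_of_le_succ fun n => (hstep n).choose
  have hLmono : Monotone L := monotone_nat_of_le_succ fun n => (hstep n).choose_spec.choose
  have hex : ∀ n, ∃ g : H → T, (∀ k ≤ n, ∀ y ∈ L n, ∀ y' ∈ L n, y - y' ∈ L k → g y - g y' ∈ K k) ∧
      (∀ k < n, ∀ y ∈ L n, ∀ y' ∈ L n, g y - g y' ∈ K k → y - y' ∈ L (k + 1)) ∧ g 0 = 0 ∧
      ∀ k < n, ∀ x ∈ K k, ∃ y ∈ L (k + 1), g y = x := by
    intro n
    have := infinite_quotient (hL n)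
    -- A patch needs `a n` cosets as its domain, one of them `L n` itself; infinitely many are
    -- available.
    obtain ⟨P, hP0, hPc⟩ := Infinite.exists_superset_card_eq {(0 : H ⧸ L n)} (a n) (by simp [ha])
    have hP0 : (0 : H ⧸ L n) ∈ P := hP0 (by simp)
    obtain ⟨g, hg⟩ := exists_isPatchMap hK0 hK hL ha hstep n P hPc.ge (by omega) 0
    have hmem : ∀ y ∈ L n, (y : H ⧸ L n) ∈ P := fun y hy => by
      rwa [(QuotientAddGroup.eq_zero_iff y).2 hy]
    refine ⟨fun y => g y - g 0, fun k hk y hy y' hy' h => ?_, fun k hk y hy y' hy' h => ?_,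
      sub_self _, fun k hk x hx => ?_⟩
    · rw [sub_sub_sub_cancel_right]
      exact hg.sub_mem y y' (hmem y hy) (hmem y' hy') k hk h
    · rw [sub_sub_sub_cancel_right] at h
      exact hg.mem_of_sub_mem y y' (hmem y hy) (hmem y' hy') k hk h
    · have h0 := hg.mk_eq 0 hP0
      obtain ⟨y, hy, hgy⟩ := hg.surj (x + g 0) (by
        rw [QuotientAddGroup.mk_add, h0, add_zero]
        exact (QuotientAddGroup.eq_zero_iff x).2 (hKmono hk.le hx))
      refine ⟨y, ?_, by simp [hgy]⟩
      rw [← sub_zero y]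
      exact hg.mem_of_sub_mem y 0 hy hP0 k hk (by rwa [hgy, add_sub_cancel_right])
  choose g hg1 hg2 hg0 hg3 using hex
  -- The maps `g n` need not be compatible. Their values at a point, and their preimages of a point,
  -- eventually stay in finite sets, so a limit along an ultrafilter exists, keeps the estimates and
  -- remains surjective.
  let U := Filter.hyperfilter ℕ
  have hU : ∀ k : ℕ, ∀ᶠ n in (U : Filter ℕ), k < n := fun k =>
    Filter.Eventually.filter_mono Nat.hyperfilter_le_atTop (Filter.eventually_gt_atTop k)
  have hlim : ∀ y, ∃ v, ∀ᶠ n in (U : Filter ℕ), g n y = v := by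
    intro y
    obtain ⟨k, hk⟩ := hLex y
    have : ∀ᶠ n in (U : Filter ℕ), ∃ v ∈ (K k : Set T), g n y = v := by
      filter_upwards [hU k] with n hn
      refine ⟨g n y, ?_, rfl⟩
      have := hg1 n k hn.le y (hLmono hn.le hk) 0 (zero_mem _) (by rwa [sub_zero])
      rwa [hg0, sub_zero] at this
    obtain ⟨v, -, hv⟩ := (Ultrafilter.eventually_exists_mem_iff (hK k)).1 this
    exact ⟨v, hv⟩
  choose f hf using hlim
  have hev : ∀ y, ∀ᶠ n in (U : Filter ℕ), y ∈ L n := fun y => by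
    obtain ⟨k, hk⟩ := hLex y
    filter_upwards [hU k] with n hn
    exact hLmono hn.le hk
  have hf1 : ∀ k y y', y - y' ∈ L k → f y - f y' ∈ K k := by
    intro k y y' h
    obtain ⟨n, hn, h1, h2, h3, h4⟩ :=
      ((hU k).and ((hf y).and ((hf y').and ((hev y).and (hev y'))))).exists
    rw [← h1, ← h2]
    exact hg1 n k hn.le y h3 y' h4 h
  have hf2 : ∀ k y y', f y - f y' ∈ K k → y - y' ∈ L (k + 1) := by
    intro k y y' h
    obtain ⟨n, hn, h1, h2, h3, h4⟩ :=
      ((hU k).and ((hf y).and ((hf y').and ((hev y).and (hev y'))))).exists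
    rw [← h1, ← h2] at h
    exact hg2 n k hn y h3 y' h4 h
  have hf3 : Function.Surjective f := by
    intro x
    obtain ⟨k, hk⟩ := hKex x
    have : ∀ᶠ n in (U : Filter ℕ), ∃ y ∈ (L (k + 1) : Set H), g n y = x := by
      filter_upwards [hU k] with n hn
      exact hg3 n k hn x hk
    obtain ⟨y, -, hy⟩ := (Ultrafilter.eventually_exists_mem_iff (hL _)).1 this
    obtain ⟨n, h1, h2⟩ := (hy.and (hf y)).exists
    exact ⟨y, h2.symm.trans h1⟩
  obtain ⟨r, hr⟩ := hf3.hasRightInverse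
  refine ⟨f, r, fun S hS => ?_, fun S hS => ?_, ⟨L 1, hL 1, fun y => ?_⟩,
    ⟨{0}, Set.finite_singleton _, fun x => by simp [hr x]⟩⟩
  · obtain ⟨k, hk⟩ := exists_subset_of_monotone hLmono hLex hS
    exact ⟨K k, hK k, fun x y hxy => hf1 k y x (hk hxy)⟩
  · obtain ⟨k, hk⟩ := exists_subset_of_monotone hKmono hKex hS
    exact ⟨L (k + 1), hL _, fun x y hxy => hf2 k _ _ (by rw [hr, hr]; exact hk hxy)⟩
  · refine hf2 0 _ _ ?_
    rw [hr (f y), sub_self]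
    exact zero_mem _

end Towers

/-! ### Rank, free subgroups and the classification. -/

section Classification

theorem natCast_le_rank_iff {G : Type*} [AddCommGroup G] (n : ℕ) :
    (n : Cardinal) ≤ Module.rank ℤ G ↔
      ∃ S : AddSubgroup G, Nonempty ((Fin n → ℤ) ≃+ S) := by
  rw [Module.le_rank_iff_exists_linearMap]
  constructor
  · rintro ⟨f, hf⟩
    exact ⟨f.toAddMonoidHom.range, ⟨AddMonoidHom.ofInjective (f := f.toAddMonoidHom) hf⟩⟩
  · rintro ⟨S, ⟨e⟩⟩
    exact ⟨(S.subtype.comp e.toAddMonoidHom).toIntLinearMap,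
      Subtype.val_injective.comp e.injective⟩

theorem torsionFreeRank_eq_toENat_rank (G : Type*) [AddCommGroup G] :
    torsionFreeRank G = Cardinal.toENat (Module.rank ℤ G) := by
  refine le_antisymm (iSup₂_le fun n hn => ?_) (ENat.forall_natCast_le_iff_le.1 fun n hn => ?_)
  · rw [Cardinal.natCast_le_toENat]
    exact (natCast_le_rank_iff n).2 hn
  · rw [Cardinal.natCast_le_toENat, natCast_le_rank_iff] at hn
    exact le_iSup₂ (f := fun (n : ℕ) (_ : ∃ S : AddSubgroup G, Nonempty ((Fin n → ℤ) ≃+ S)) =>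
        (n : ℕ∞)) n hn

theorem exists_free_subgroup_torsion_quotient (G : Type*) [AddCommGroup G] :
    ∃ (s : Set G) (F : AddSubgroup G), Nonempty (F ≃+ (s →₀ ℤ)) ∧ IsAddTorsion (G ⧸ F) ∧
      ENat.card s = torsionFreeRank G := by
  -- Maximality gives every element a nonzero multiple in the span, so the quotient is torsion;
  -- additivity of rank then identifies the size of `s`.
  obtain ⟨s, hs, hmax⟩ := exists_maximal_linearIndepOn ℤ (id : G → G)
  let N : Submodule ℤ G := Submodule.span ℤ (Set.range fun x : s => (x : G))
  have hN : ∀ g : G, ∃ a : ℤ, a ≠ 0 ∧ a • g ∈ N := by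
    intro g
    by_cases hg : g ∈ s
    · exact ⟨1, one_ne_zero, by
        rw [one_smul]; exact Submodule.subset_span ⟨⟨g, hg⟩, rfl⟩⟩
    · simpa [N] using hmax g hg
  have hli : LinearIndependent ℤ (fun x : s => (x : G)) := hs
  refine ⟨s, N.toAddSubgroup, ⟨hli.linearCombinationEquiv.symm.toAddEquiv⟩, fun x => ?_, ?_⟩
  · obtain ⟨g, rfl⟩ := QuotientAddGroup.mk_surjective x
    obtain ⟨a, ha, hag⟩ := hN g
    rw [isOfFinAddOrder_iff_zsmul_eq_zero]
    refine ⟨a, ha, ?_⟩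
    rw [← QuotientAddGroup.mk_zsmul]
    exact (QuotientAddGroup.eq_zero_iff _).2 hag
  · have htors : Module.rank ℤ (G ⧸ N) = 0 := by
      rw [Module.rank_eq_zero_iff_isTorsion]
      intro x
      obtain ⟨g, rfl⟩ := N.mkQ_surjective x
      obtain ⟨a, ha, hag⟩ := hN g
      refine ⟨⟨a, mem_nonZeroDivisors_of_ne_zero ha⟩, ?_⟩
      rw [Submonoid.mk_smul, ← map_smul]
      exact (Submodule.Quotient.mk_eq_zero N).2 hag
    have hrank := rank_quotient_add_rank_of_isDomain N
    rw [htors, zero_add, rank_span hli, Cardinal.mk_range_eq _ Subtype.val_injective] at hrank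
    rw [torsionFreeRank_eq_toENat_rank, ← hrank]
    rfl

theorem fg_of_finite_quotient {G : Type*} [AddCommGroup G] (F : AddSubgroup G)
    (hF : AddGroup.FG F) [Finite (G ⧸ F)] : AddGroup.FG G := by
  obtain ⟨S, hS, hSf⟩ := AddSubgroup.fg_iff F |>.1 ((AddGroup.fg_iff_addSubgroup_fg F).1 hF)
  refine AddGroup.fg_iff.2 ⟨S ∪ Set.range (Quotient.out : G ⧸ F → G), ?_,
    hSf.union (Set.finite_range _)⟩
  rw [eq_top_iff]
  rintro x -
  rw [← sub_add_cancel x (Quotient.out (x : G ⧸ F))]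
  refine add_mem ?_ (AddSubgroup.subset_closure (Or.inr ⟨_, rfl⟩))
  refine AddSubgroup.closure_mono Set.subset_union_left ?_
  rw [hS, ← QuotientAddGroup.eq_iff_sub_mem]
  exact (Quotient.out_eq _).symm

theorem isAddTorsion_prod {A B : Type*} [AddCommGroup A] [AddCommGroup B] (hA : IsAddTorsion A)
    (hB : IsAddTorsion B) : IsAddTorsion (A × B) := by
  rintro ⟨a, b⟩
  obtain ⟨m, hm, hma⟩ := isOfFinAddOrder_iff_nsmul_eq_zero.1 (hA a)
  obtain ⟨n, hn, hnb⟩ := isOfFinAddOrder_iff_nsmul_eq_zero.1 (hB b)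
  refine isOfFinAddOrder_iff_nsmul_eq_zero.2 ⟨m * n, Nat.mul_pos hm hn, ?_⟩
  ext
  · simp [mul_comm m n, mul_nsmul', hma]
  · simp [mul_nsmul', hnb]

/-- A free abelian group of countably infinite rank absorbs an infinite torsion factor. -/
theorem exists_finEquiv_free_prod (ι : Type*) [Countable ι] [Infinite ι] :
    ∃ F : AddSubgroup (ι →₀ ℤ), IsAddTorsion ((ι →₀ ℤ) ⧸ F) ∧ Infinite ((ι →₀ ℤ) ⧸ F) ∧
      FinEquiv (ι →₀ ℤ) ((ι →₀ ℤ) × ((ι →₀ ℤ) ⧸ F)) := by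
  classical
  -- Doubling is injective, so its range is a copy of the whole group, while the basis vectors stay
  -- distinct in the quotient, which has exponent two.
  let f : (ι →₀ ℤ) →+ (ι →₀ ℤ) := nsmulAddMonoidHom 2
  have hf : Function.Injective f := fun a b hab => nsmul_right_injective two_ne_zero hab
  have htors : IsAddTorsion ((ι →₀ ℤ) ⧸ f.range) := by
    intro x
    obtain ⟨g, rfl⟩ := QuotientAddGroup.mk_surjective x
    refine isOfFinAddOrder_iff_nsmul_eq_zero.2 ⟨2, two_pos, ?_⟩
    rw [← QuotientAddGroup.mk_nsmul]
    exact (QuotientAddGroup.eq_zero_iff _).2 ⟨g, rfl⟩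
  refine ⟨f.range, htors, ?_, (FinEquiv.prod_quotient f.range htors).trans
    ((FinEquiv.of_addEquiv (AddMonoidHom.ofInjective hf).symm).prod (FinEquiv.refl _))⟩
  refine Infinite.of_injective (fun i : ι => ((Finsupp.single i 1 : ι →₀ ℤ) : _ ⧸ f.range)) ?_
  intro i j hij
  obtain ⟨g, hg⟩ := QuotientAddGroup.eq_iff_sub_mem.1 hij
  by_contra hne
  have := DFunLike.congr_fun hg i
  simp [f, Ne.symm hne] at this
  omega

theorem finEquiv_free_of_fg {G : Type*} [AddCommGroup G] [Countable G] (hG : AddGroup.FG G) :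
    ∃ s : Set G, ENat.card s = torsionFreeRank G ∧ FinEquiv G (s →₀ ℤ) := by
  obtain ⟨s, F, ⟨e⟩, hF, hs⟩ := exists_free_subgroup_torsion_quotient G
  refine ⟨s, hs, (FinEquiv.prod_quotient F hF).trans ?_⟩
  have : AddGroup.FG (G ⧸ F) := AddGroup.fg_of_surjective (QuotientAddGroup.mk'_surjective F)
  have : Finite (G ⧸ F) := AddCommGroup.finite_of_fg_isAddTorsion _ hF
  exact (FinEquiv.prod_finite F (G ⧸ F)).trans (.of_addEquiv e)

/-- In finite rank the quotient is infinite because `G` is not finitely generated; in infinite rank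
the free factor yields an infinite torsion factor. -/
theorem finEquiv_free_prod_of_not_fg.{u} {G : Type u} [AddCommGroup G] [Countable G]
    (hG : ¬ AddGroup.FG G) :
    ∃ (s : Set G) (T : Type u) (_ : AddCommGroup T), ENat.card s = torsionFreeRank G ∧
      Countable T ∧ Infinite T ∧ IsAddTorsion T ∧ FinEquiv G ((s →₀ ℤ) × T) := by
  obtain ⟨s, F, ⟨e⟩, hF, hs⟩ := exists_free_subgroup_torsion_quotient G
  have hQ : Countable (G ⧸ F) := (QuotientAddGroup.mk'_surjective F).countable
  have hE : FinEquiv G ((s →₀ ℤ) × (G ⧸ F)) :=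
    (FinEquiv.prod_quotient F hF).trans ((FinEquiv.of_addEquiv e).prod (.refl _))
  rcases finite_or_infinite s with hfin | hinf
  · refine ⟨s, G ⧸ F, inferInstance, hs, hQ, ?_, hF, hE⟩
    by_contra hQfin
    rw [not_infinite_iff_finite] at hQfin
    have : Module.Finite ℤ (s →₀ ℤ) := inferInstance
    have : AddGroup.FG (s →₀ ℤ) := Module.Finite.iff_addGroup_fg.1 this
    exact hG (fg_of_finite_quotient F (AddGroup.fg_of_surjective (f := e.symm.toAddMonoidHom)
      e.symm.surjective))
  · obtain ⟨F', hF', hinf', hE'⟩ := exists_finEquiv_free_prod s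
    have : Countable ((s →₀ ℤ) ⧸ F') := (QuotientAddGroup.mk'_surjective F').countable
    refine ⟨s, ((s →₀ ℤ) ⧸ F') × (G ⧸ F), inferInstance, hs, inferInstance, inferInstance,
      isAddTorsion_prod hF' hF, hE.trans ((hE'.prod (.refl _)).trans
        (.of_addEquiv AddEquiv.prodAssoc))⟩

theorem nonempty_equiv_of_card_eq {α β : Type*} [Countable α] [Countable β]
    (h : ENat.card α = ENat.card β) : Nonempty (α ≃ β) := by
  rcases finite_or_infinite α with hα | hα
  · have hβ : Finite β := by
      rw [← ENat.card_lt_top, ← h, ENat.card_lt_top]; exact hα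
    exact Finite.card_eq.1 (congrArg ENat.toNat h)
  · have hβ : Infinite β := by
      rw [← not_finite_iff_infinite, ← ENat.card_lt_top, ← h, ENat.card_lt_top]
      exact not_finite_iff_infinite.2 hα
    obtain ⟨d⟩ := nonempty_denumerable α
    obtain ⟨d'⟩ := nonempty_denumerable β
    exact ⟨Denumerable.equiv₂ α β⟩

theorem finEquiv_of_torsionFreeRank_eq {G H : Type*} [AddCommGroup G] [Countable G]
    [AddCommGroup H] [Countable H] (h : torsionFreeRank G = torsionFreeRank H)
    (hfg : AddGroup.FG G ↔ AddGroup.FG H) : FinEquiv G H := by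
  by_cases hG : AddGroup.FG G
  · obtain ⟨s, hs, hGs⟩ := finEquiv_free_of_fg hG
    obtain ⟨t, ht, hHt⟩ := finEquiv_free_of_fg (hfg.1 hG)
    obtain ⟨e⟩ := nonempty_equiv_of_card_eq (hs.trans (h.trans ht.symm))
    exact hGs.trans ((FinEquiv.of_addEquiv (Finsupp.domCongr e)).trans hHt.symm)
  · obtain ⟨s, T, _, hs, hT1, hT2, hT3, hGs⟩ := finEquiv_free_prod_of_not_fg hG
    obtain ⟨t, U, _, ht, hU1, hU2, hU3, hHt⟩ := finEquiv_free_prod_of_not_fg (mt hfg.2 hG)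
    obtain ⟨e⟩ := nonempty_equiv_of_card_eq (hs.trans (h.trans ht.symm))
    exact hGs.trans (((FinEquiv.of_addEquiv (Finsupp.domCongr e)).prod
      (FinEquiv.of_infinite_torsion hU3 hT3)).trans hHt.symm)

end Classification

end CoarseGeom

end

theorem theorem1
    {G : Type*} [AddCommGroup G] [Countable G] [MetricSpace G] [ProperSpace G]
    [IsIsometricVAdd G G]
    {H : Type*} [AddCommGroup H] [Countable H] [MetricSpace H] [ProperSpace H]
    [IsIsometricVAdd H H] :
    List.TFAE
      [CoarseGeom.CoarselyEquivalent G H,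
       CoarseGeom.asdim G = CoarseGeom.asdim H ∧
         (CoarseGeom.LargeScaleConnected G ↔ CoarseGeom.LargeScaleConnected H),
       CoarseGeom.torsionFreeRank G = CoarseGeom.torsionFreeRank H ∧
         (AddGroup.FG G ↔ AddGroup.FG H)] := by
  tfae_have 1 → 2 := fun h => ⟨CoarseGeom.asdim_eq_of_coarselyEquivalent h,
    .of_coarselyEquivalent h, .of_coarselyEquivalent h.symm⟩
  tfae_have 2 ↔ 3 := by
    rw [CoarseGeom.asdim_eq_torsionFreeRank, CoarseGeom.asdim_eq_torsionFreeRank,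
      CoarseGeom.largeScaleConnected_iff_fg, CoarseGeom.largeScaleConnected_iff_fg]
  tfae_have 3 → 1 := fun h =>
    (CoarseGeom.finEquiv_of_torsionFreeRank_eq h.1 h.2).coarselyEquivalent
  tfae_finish
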